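/- Let $T>0$, $\omega=2\pi/T$, $n\ge 0$, and let $A:\mathbb R\to\mathbb C^{n\times n}$ be $T$-periodic with entries in $L^2([0,T])$. Write $a_{ij,k}=\frac1T\int_0^T a_{ij}(\tau)e^{-\mathrm i\omega k\tau}\,d\tau$ for the Fourier coefficients of the entries of $A$. Let $\mathcal A$ be the infinite block Toeplitz matrix whose block $(i,j)$ is $(a_{ij,k-p})_{k,p\in\mathbb Z}$, and let $\mathcal N=\mathrm{Id}_n\otimes\mathrm{diag}(\mathrm i\omega k,\ k\in\mathbb Z)$. Regard $\mathcal A-\mathcal N$ as an unbounded operator on $\ell^2(\mathbb Z;\mathbb C^n)$ with its maximal domain, i.e. all $X\in\ell^2$ for which the row sums of $(\mathcal A-\mathcal N)X$ converge absolutely and $(\mathcal A-\mathcal N)X\in\ell^2$. Then there is a unique state transition matrix $t\mapsto\Phi(t,0)$, $t\in\mathbb R$, of $\dot x=A(t)x$: its $i$-th column is locally absolutely continuous, satisfies $\dot x(t)=A(t)x(t)$ for almost every $t$, and equals the canonical basis vector $e_i$ at $t=0$. Moreover, $\mathcal A-\mathcal N$ is non-defective if and only if the monodromy matrix $\Phi(T,0)$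 is non-defective (i.e. $\mathbb C^n$ has a basis of eigenvectors of $\Phi(T,0)$). This holds for each of the two usual meanings of non-defectiveness of the operator $\mathcal A-\mathcal N$: 1. $\ell^2(\mathbb Z;\mathbb C^n)$ has a Riesz basis (the image of the canonical basis of some $\ell^2(I)$ under a bounded operator with bounded inverse) consisting of eigenvectors of $\mathcal A-\mathcal N$; 2. every generalized eigenvector of $\mathcal A-\mathcal N$ is an eigenvector, i.e. $\ker(\mathcal A-\mathcal N-\mu)^k\subseteq\ker(\mathcal A-\mathcal N-\mu)$ for all $\mu\in\mathbb C$ and $k\ge 0$. -/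

import Mathlib

open scoped Matrix
open MeasureTheory

noncomputable section

/-! ### Infinite matrices as unbounded operators on `ℓ²` -/

/-- The Hilbert space `ℓ²(ι; ℂ)` of square-summable complex families. -/
abbrev EllTwo (ι : Type*) : Type _ := lp (fun _ : ι => ℂ) 2

/-- The (in general unbounded) operator on `ℓ²(ι)` defined by an infinite matrix `M`, with its maximal
domain: all `X ∈ ℓ²` such that every row sum `∑ₛ M r s * X s` converges absolutely and the
resulting family `M X` is again in `ℓ²`. -/
def matrixOperator {ι : Type*} (M : Matrix ι ι ℂ) : EllTwo ι →ₗ.[ℂ] EllTwo ι where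
  domain :=
    { carrier := {X | (∀ r, Summable fun s => M r s * X s) ∧
        Memℓp (fun r => ∑' s, M r s * X s) 2}
      zero_mem' := by
        refine ⟨fun r => ?_, ?_⟩
        · simp [summable_zero]
        · have h : (fun r => ∑' s, M r s * (0 : EllTwo ι) s) = 0 := by
            funext r
            simp
          rw [h]
          exact zero_memℓp
      add_mem' := by
        rintro X Y ⟨hX, hX'⟩ ⟨hY, hY'⟩
        refine ⟨fun r => ?_, ?_⟩
        · simpa [mul_add] using (hX r).add (hY r)
        · have h : (fun r => ∑' s, M r s * (X + Y : EllTwo ι) s) =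
              (fun r => ∑' s, M r s * X s) + fun r => ∑' s, M r s * Y s := by
            funext r
            simpa [mul_add] using (hX r).tsum_add (hY r)
          rw [h]
          exact hX'.add hY'
      smul_mem' := by
        rintro c X ⟨hX, hX'⟩
        refine ⟨fun r => ?_, ?_⟩
        · simpa [mul_left_comm] using (hX r).mul_left c
        · have h : (fun r => ∑' s, M r s * (c • X : EllTwo ι) s) =
              c • fun r => ∑' s, M r s * X s := by
            funext r
            simp [mul_left_comm, tsum_mul_left]
          rw [h]
          exact hX'.const_smul c }
  toFun :=
    { toFun := fun X => ⟨fun r => ∑' s, M r s * X.1 s, X.2.2⟩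
      map_add' := by
        rintro ⟨X, hX⟩ ⟨Y, hY⟩
        ext r
        refine Eq.trans ?_ ((hX.1 r).tsum_add (hY.1 r))
        simp [mul_add]
      map_smul' := by
        rintro c ⟨X, hX⟩
        ext r
        simp [mul_left_comm, tsum_mul_left] }

/-! ### The harmonic state operator -/

/-- The `k`-th Fourier coefficient (phasor) `(1/T) ∫₀ᵀ a(τ) e^{-jωkτ} dτ`, `ω = 2π/T`, of a
`T`-periodic function `a`. By periodicity any window of length `T` gives the same value. -/
def phasor (T : ℝ) (a : ℝ → ℂ) (k : ℤ) : ℂ :=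
  (1 / (T : ℂ)) * ∫ τ in (0 : ℝ)..T,
    a τ * Complex.exp (-(Complex.I * ((2 * Real.pi / T : ℝ) : ℂ) * (k : ℂ) * (τ : ℂ)))

/-- The block Toeplitz transformation `𝒜 = 𝒯(A)`: an `n × n` array of bi-infinite blocks, the block
`(i, j)` having entry `(k, p)` equal to the phasor of `a_{ij}` of index `k - p`. -/
def blockToeplitz {n : ℕ} (T : ℝ) (A : ℝ → Matrix (Fin n) (Fin n) ℂ) :
    Matrix (Fin n × ℤ) (Fin n × ℤ) ℂ :=
  Matrix.of fun r s => phasor T (fun t => A t r.1 s.1) (r.2 - s.2)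

/-- `𝒩 = Id_n ⊗ diag(jωk, k ∈ ℤ)`, with `ω = 2π/T`. -/
def harmonicDiagonal (n : ℕ) (T : ℝ) : Matrix (Fin n × ℤ) (Fin n × ℤ) ℂ :=
  Matrix.diagonal fun r => Complex.I * ((2 * Real.pi / T : ℝ) : ℂ) * (r.2 : ℂ)

/-- The harmonic state operator `𝒜 - 𝒩` on `ℓ²(Fin n × ℤ)`, that is, on `ℓ²(ℤ; ℂⁿ)`. -/
def harmonicStateOperator {n : ℕ} (T : ℝ) (A : ℝ → Matrix (Fin n) (Fin n) ℂ) :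
    EllTwo (Fin n × ℤ) →ₗ.[ℂ] EllTwo (Fin n × ℤ) :=
  matrixOperator (blockToeplitz T A - harmonicDiagonal n T)

/-! ### The state transition matrix -/

/-- `x` solves `ẋ(t) = A(t) x(t)`, `x(0) = x₀` on `ℝ` in the sense of Carathéodory: `x` is
absolutely continuous on every bounded interval and the equation holds for almost every `t`. -/
def IsCaratheodorySolution {n : ℕ} (A : ℝ → Matrix (Fin n) (Fin n) ℂ) (x₀ : Fin n → ℂ)
    (x : ℝ → Fin n → ℂ) : Prop :=
  x 0 = x₀ ∧ (∀ a b : ℝ, AbsolutelyContinuousOnInterval x a b) ∧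
    ∀ᵐ t : ℝ, HasDerivAt x (A t *ᵥ x t) t

/-- `Φ t` is the state transition (Wronski) matrix `Φ(t, 0)`: its `i`-th column is the solution
with initial condition `e_i`. -/
def IsStateTransitionMatrix {n : ℕ} (A : ℝ → Matrix (Fin n) (Fin n) ℂ)
    (Φ : ℝ → Matrix (Fin n) (Fin n) ℂ) : Prop :=
  ∀ i : Fin n, IsCaratheodorySolution A (Pi.single i 1) fun t => (Φ t).col i

/-! ### Non-defectiveness -/

/-- A square matrix is non-defective if `ℂⁿ` has a basis consisting of eigenvectors. -/
def MatrixNonDefective {n : ℕ} (M : Matrix (Fin n) (Fin n) ℂ) : Prop :=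
  ∃ b : Module.Basis (Fin n) ℂ (Fin n → ℂ),
    ∀ i, ∃ μ : ℂ, Module.End.HasEigenvector (Matrix.toLin' M) μ (b i)

section Operators

variable {E : Type*} [NormedAddCommGroup E] [NormedSpace ℂ E]

/-- `x` is an eigenvector of the unbounded operator `L` for the eigenvalue `μ`. -/
def IsEigenvector (L : E →ₗ.[ℂ] E) (μ : ℂ) (x : E) : Prop :=
  x ≠ 0 ∧ ∃ hx : x ∈ L.domain, L ⟨x, hx⟩ = μ • x

/-- `x ∈ ker (L - μ)ᵏ`, the successive images being required to stay in the domain of `L`. -/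
def InGeneralizedKernel (L : E →ₗ.[ℂ] E) (μ : ℂ) : ℕ → E → Prop
  | 0, x => x = 0
  | k + 1, x => ∃ hx : x ∈ L.domain, InGeneralizedKernel L μ k (L ⟨x, hx⟩ - μ • x)

/-- Non-defective, as a statement on eigenvalues: every generalized eigenvector of `L` is an
eigenvector, i.e. `ker (L - μ)ᵏ ⊆ ker (L - μ)` for all `μ` and `k`. -/
def EveryGenEigenvectorIsEigenvector (L : E →ₗ.[ℂ] E) : Prop :=
  ∀ (μ : ℂ) (k : ℕ) (x : E), InGeneralizedKernel L μ k x → x ≠ 0 → IsEigenvector L μ x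

/-- Non-defective, as a statement on diagonalization: the space has a Riesz basis (the image of the
canonical basis of some `ℓ²(ι)` under a bounded operator with bounded inverse) consisting of
eigenvectors of `L`. -/
def HasRieszBasisOfEigenvectors (L : E →ₗ.[ℂ] E) : Prop :=
  ∃ (ι : Type) (_ : DecidableEq ι) (S : EllTwo ι ≃L[ℂ] E),
    ∀ i : ι, ∃ μ : ℂ, IsEigenvector L μ (S (lp.single 2 i 1))

end Operators

end

/-! Taking phasors is a unitary map from `L²((0,T]; ℂⁿ)` onto `ℓ²`. Under it, `𝒜 - 𝒩` with its
maximal domain becomes `x ↦ A x - ẋ` on those absolutely continuous `x` with `x(T) = x(0)` for which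
`A x - ẋ` is in `L²` (`harmonicStateOperator_of_solution`, `exists_solution_of_mem_domain`).
Although `A x` is only integrable, each row sum converges to a phasor of `A x` by Parseval
(`hasSum_blockToeplitz`).

Spectral questions thus become periodic boundary value problems. The eigenfunctions for `μ` are
`e^{-μt} Φ(t) c` with `Φ(T) c = e^{μT} c`. A chain `(L - μ) x = y`, `(L - μ) y = 0` is solved by `x
= e^{-μt} Φ(t) (c - t d)`, `y = e^{-μt} Φ(t) d`, and periodicity of `x` reads `Φ(T) c = e^{μT} c + T
Φ(T) d` (`shiftedSolution_period_iff`). Jordan chains of the operator and of the monodromy matrix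
therefore correspond; every eigenvalue of the invertible matrix `Φ(T)` has a logarithm. This settles
meaning 2.

For meaning 1, an eigenbasis of `Φ(T)` yields, as in Floquet theory, a continuous invertible matrix
function that multiplies the Fourier basis into eigenfunctions. Conversely, if the eigenvectors of
`Φ(T)` do not span, a functional `f ≠ 0` kills them all, and the conjugate of `f Ψ(t)`, with `Ψ =
Φ⁻¹`, is orthogonal to every eigenfunction, so these are not even total.

Solutions are built by Picard iteration. Uniqueness and invertibility both come from the adjoint
equation, whose solutions have constant pairing with those of `ẋ = A x`. -/

noncomputable section

/-! ### Vector-valued absolutely continuous functions -/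

section AbsolutelyContinuous

variable {E : Type*} [NormedAddCommGroup E] [NormedSpace ℝ E]

-- Absolute continuity only sees distances between values at endpoints. This reduces vector
-- primitives, coordinates and translates to known cases.
open Set Filter Topology in
theorem AbsolutelyContinuousOnInterval.of_dist_le {X Y : Type*} [PseudoMetricSpace X]
    [PseudoMetricSpace Y] {f : ℝ → X} {g : ℝ → Y} {a b : ℝ}
    (hg : AbsolutelyContinuousOnInterval g a b)
    (h : ∀ x ∈ uIcc a b, ∀ y ∈ uIcc a b, dist (f x) (f y) ≤ dist (g x) (g y)) :
    AbsolutelyContinuousOnInterval f a b := by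
  rw [absolutelyContinuousOnInterval_iff] at hg ⊢
  intro ε hε
  obtain ⟨δ, hδ, H⟩ := hg ε hε
  refine ⟨δ, hδ, fun I hI hd => lt_of_le_of_lt ?_ (H I hI hd)⟩
  exact Finset.sum_le_sum fun i hi => h _ (hI.1 i hi).1 _ (hI.1 i hi).2

theorem AbsolutelyContinuousOnInterval.finsetSum {F : Type*} [NormedAddCommGroup F]
    {ι : Type*} (s : Finset ι) {f : ι → ℝ → F}
    {a b : ℝ} (hf : ∀ i ∈ s, AbsolutelyContinuousOnInterval (f i) a b) :
    AbsolutelyContinuousOnInterval (fun t => ∑ i ∈ s, f i t) a b := by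
  classical
  induction s using Finset.induction_on with
  | empty =>
    simp only [Finset.sum_empty]
    exact (LipschitzWith.const (0 : F)).lipschitzOnWith.absolutelyContinuousOnInterval
  | insert i s hi ih =>
    simp only [Finset.sum_insert hi]
    exact (hf i (Finset.mem_insert_self i s)).add
      (ih fun j hj => hf j (Finset.mem_insert_of_mem hj))

theorem AbsolutelyContinuousOnInterval.apply {n : ℕ} {x : ℝ → Fin n → ℂ} {a b : ℝ}
    (hx : AbsolutelyContinuousOnInterval x a b) (i : Fin n) :
    AbsolutelyContinuousOnInterval (fun t => x t i) a b :=
  hx.of_dist_le fun _ _ _ _ => dist_le_pi_dist _ _ i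

theorem ContDiff.absolutelyContinuousOnInterval {f : ℝ → E} (hf : ContDiff ℝ 1 f) (a b : ℝ) :
    AbsolutelyContinuousOnInterval f a b :=
  hf.contDiffOn.absolutelyContinuousOnInterval

theorem IntervalIntegrable.absolutelyContinuousOnInterval_integral [CompleteSpace E] {f : ℝ → E}
    {a b c : ℝ} (hf : IntervalIntegrable f volume a b) (hc : c ∈ Set.uIcc a b) :
    AbsolutelyContinuousOnInterval (fun t => ∫ s in c..t, f s) a b := by
  refine (hf.norm.absolutelyContinuousOnInterval_intervalIntegral hc).of_dist_le ?_
  intro x hx y hy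
  have h1 : ∀ z ∈ Set.uIcc a b, IntervalIntegrable f volume c z := fun z hz =>
    hf.mono_set (Set.uIcc_subset_uIcc hc hz)
  rw [dist_eq_norm, dist_eq_norm, intervalIntegral.integral_interval_sub_left (h1 x hx) (h1 y hy),
    intervalIntegral.integral_interval_sub_left (h1 x hx).norm (h1 y hy).norm]
  exact intervalIntegral.norm_integral_le_abs_integral_norm

/-- Subtracting the primitive of `f` leaves an absolutely continuous function with zero derivative
almost everywhere, hence a constant. -/
theorem AbsolutelyContinuousOnInterval.integral_eq_sub_of_ae_hasDerivAt [CompleteSpace E]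
    {x f : ℝ → E} {a b : ℝ} (hx : AbsolutelyContinuousOnInterval x a b)
    (hd : ∀ᵐ t, t ∈ Set.uIcc a b → HasDerivAt x (f t) t)
    (hf : IntervalIntegrable f volume a b) : ∫ t in a..b, f t = x b - x a := by
  have h2 : ∀ᵐ t, t ∈ Set.uIcc a b → HasDerivAt (fun t => x t - ∫ s in a..t, f s) 0 t := by
    filter_upwards [hd, hf.ae_hasDerivAt_integral] with t h3 h4 ht
    simpa [Pi.sub_def] using (h3 ht).sub (h4 ht a (by simp))
  obtain ⟨C, hC⟩ := (hx.sub (hf.absolutelyContinuousOnInterval_integral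
    (by simp))).const_of_ae_hasDerivAt_zero h2
  have ha := hC a (by simp)
  have hb := hC b (by simp)
  simp only [Pi.sub_apply, intervalIntegral.integral_same, sub_zero] at ha hb
  rw [ha, ← hb]
  abel

theorem AbsolutelyContinuousOnInterval.eq_of_ae_hasDerivAt_zero {x : ℝ → E} {a b t : ℝ}
    (hx : AbsolutelyContinuousOnInterval x a b)
    (hd : ∀ᵐ t, t ∈ Set.uIcc a b → HasDerivAt x 0 t) (ht : t ∈ Set.uIcc a b) : x t = x a := by
  obtain ⟨C, hC⟩ := hx.const_of_ae_hasDerivAt_zero hd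
  rw [hC t ht, hC a (by simp)]

end AbsolutelyContinuous

/-! ### Existence of Carathéodory solutions by Picard iteration -/

section Caratheodory

variable {n : ℕ}

theorem norm_mulVec_le_sum_norm_mul (A : Matrix (Fin n) (Fin n) ℂ) (v : Fin n → ℂ) :
    ‖A *ᵥ v‖ ≤ (∑ i, ∑ j, ‖A i j‖) * ‖v‖ := by
  have h0 : 0 ≤ (∑ i, ∑ j, ‖A i j‖) := by positivity
  refine (pi_norm_le_iff_of_nonneg (by positivity)).2 fun i => ?_
  calc ‖(A *ᵥ v) i‖ ≤ ∑ j, ‖A i j * v j‖ := norm_sum_le Finset.univ fun j => A i j * v j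
    _ ≤ ∑ j, ‖A i j‖ * ‖v‖ := by
        refine Finset.sum_le_sum fun j _ => ?_
        rw [norm_mul]
        gcongr
        exact norm_le_pi_norm v j
    _ = (∑ j, ‖A i j‖) * ‖v‖ := (Finset.sum_mul _ _ _).symm
    _ ≤ _ := by
        exact mul_le_mul_of_nonneg_right (Finset.single_le_sum (f := fun i => ∑ j, ‖A i j‖)
          (fun _ _ => by positivity) (Finset.mem_univ i)) (norm_nonneg v)

theorem intervalIntegrable_pi {f : ℝ → Fin n → ℂ} {a b : ℝ}
    (h : ∀ i, IntervalIntegrable (fun t => f t i) volume a b) :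
    IntervalIntegrable f volume a b :=
  ⟨Integrable.of_eval fun i => (h i).1, Integrable.of_eval fun i => (h i).2⟩

theorem intervalIntegral_apply {f : ℝ → Fin n → ℂ} {a b : ℝ}
    (h : IntervalIntegrable f volume a b) (i : Fin n) :
    (∫ t in a..b, f t) i = ∫ t in a..b, f t i := by
  exact ((ContinuousLinearMap.proj (R := ℝ) (φ := fun _ : Fin n => ℂ)
    i).intervalIntegral_comp_comm h).symm

theorem intervalIntegrable_mulVec {A : ℝ → Matrix (Fin n) (Fin n) ℂ} {x : ℝ → Fin n → ℂ} {a b : ℝ}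
    (hA : ∀ i j, IntervalIntegrable (fun t => A t i j) volume a b)
    (hx : ContinuousOn x (Set.uIcc a b)) :
    IntervalIntegrable (fun t => A t *ᵥ x t) volume a b := by
  refine intervalIntegrable_pi fun i => ?_
  have h : (fun t => (A t *ᵥ x t) i) = ∑ j, fun t => A t i j * x t j := by
    funext t
    simp [Matrix.mulVec, dotProduct]
  rw [h]
  exact IntervalIntegrable.sum _ fun j _ =>
    (hA i j).mul_continuousOn ((continuous_apply j).comp_continuousOn hx)

theorem intervalIntegrable_sum_norm {A : ℝ → Matrix (Fin n) (Fin n) ℂ}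
    (hA : ∀ i j a b, IntervalIntegrable (fun t => A t i j) volume a b) (a b : ℝ) :
    IntervalIntegrable (fun s => ∑ i, ∑ j, ‖A s i j‖) volume a b := by
  have h : (fun s => ∑ i, ∑ j, ‖A s i j‖) = ∑ i, ∑ j, fun s => ‖A s i j‖ := by
    funext s
    simp
  rw [h]
  exact IntervalIntegrable.sum _ fun i _ => IntervalIntegrable.sum _ fun j _ => (hA i j a b).norm

/-- The Picard iterates of the linear equation `ẋ = A x`, whose sum is the solution. -/
def picardTerm (A : ℝ → Matrix (Fin n) (Fin n) ℂ) (x₀ : Fin n → ℂ) : ℕ → ℝ → Fin n → ℂ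
  | 0 => fun _ => x₀
  | k + 1 => fun t => ∫ s in (0 : ℝ)..t, A s *ᵥ picardTerm A x₀ k s

theorem continuous_picardTerm {A : ℝ → Matrix (Fin n) (Fin n) ℂ}
    (hA : ∀ i j a b, IntervalIntegrable (fun t => A t i j) volume a b) (x₀ : Fin n → ℂ) (k : ℕ) :
    Continuous (picardTerm A x₀ k) := by
  induction k with
  | zero => exact continuous_const
  | succ k ih =>
    exact intervalIntegral.continuous_primitive
      (fun a b => intervalIntegrable_mulVec (fun i j => hA i j a b) ih.continuousOn) 0

/-- The integrand is, up to the factor `k + 1`, the almost everywhere derivative of a power of the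
primitive; `a` need not be continuous. -/
theorem integral_mul_primitive_pow {a : ℝ → ℝ} (ha : ∀ u v, IntervalIntegrable a volume u v)
    (k : ℕ) (t : ℝ) :
    ∫ s in (0 : ℝ)..t, a s * (∫ r in (0 : ℝ)..s, a r) ^ k =
      (∫ r in (0 : ℝ)..t, a r) ^ (k + 1) / (k + 1) := by
  have hac := (ha 0 t).absolutelyContinuousOnInterval_integral (c := 0) (by simp)
  have hpow : ∀ m : ℕ, AbsolutelyContinuousOnInterval
      (fun s => (∫ r in (0 : ℝ)..s, a r) ^ m) 0 t := by
    intro m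
    induction m with
    | zero => simpa using
        (contDiff_const (c := (1 : ℝ))).absolutelyContinuousOnInterval (E := ℝ) 0 t
    | succ m ih => simpa [pow_succ] using ih.fun_mul hac
  have hd : ∀ᵐ s, s ∈ Set.uIcc 0 t → HasDerivAt (fun s => (∫ r in (0 : ℝ)..s, a r) ^ (k + 1))
      ((k + 1) * (a s * (∫ r in (0 : ℝ)..s, a r) ^ k)) s := by
    filter_upwards [(ha 0 t).ae_hasDerivAt_integral] with s hs hs'
    refine ((hs hs' 0 (by simp)).fun_pow (k + 1)).congr_deriv ?_
    rw [Nat.add_sub_cancel]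
    push_cast
    ring
  have hi := (hpow (k + 1)).integral_eq_sub_of_ae_hasDerivAt hd
    (((ha 0 t).mul_continuousOn (hpow k).continuousOn).const_mul _)
  rw [intervalIntegral.integral_const_mul] at hi
  have hk : (k + 1 : ℝ) ≠ 0 := by positivity
  rw [eq_div_iff hk, mul_comm, hi]
  simp

/-- Since `a ≥ 0`, its primitive has the sign of `s`, so for `t ≤ 0` the inner absolute value only
costs a global factor `(-1)^k`. -/
theorem abs_integral_mul_abs_primitive_pow {a : ℝ → ℝ}
    (ha : ∀ u v, IntervalIntegrable a volume u v) (ha0 : ∀ t, 0 ≤ a t) (k : ℕ) (t : ℝ) :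
    |∫ s in (0 : ℝ)..t, a s * |∫ r in (0 : ℝ)..s, a r| ^ k| =
      |∫ r in (0 : ℝ)..t, a r| ^ (k + 1) / (k + 1) := by
  have key : |∫ s in (0 : ℝ)..t, a s * |∫ r in (0 : ℝ)..s, a r| ^ k| =
      |∫ s in (0 : ℝ)..t, a s * (∫ r in (0 : ℝ)..s, a r) ^ k| := by
    rcases le_total 0 t with ht | ht
    · congr 1
      refine intervalIntegral.integral_congr fun s hs => ?_
      rw [Set.uIcc_of_le ht] at hs
      rw [abs_of_nonneg (intervalIntegral.integral_nonneg hs.1 fun u _ => ha0 u)]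
    · rw [← abs_neg (∫ s in (0 : ℝ)..t, a s * (∫ r in (0 : ℝ)..s, a r) ^ k)]
      have : ∀ s ∈ Set.uIcc 0 t, a s * |∫ r in (0 : ℝ)..s, a r| ^ k =
          (-1) ^ k * (a s * (∫ r in (0 : ℝ)..s, a r) ^ k) := by
        intro s hs
        rw [Set.uIcc_of_ge ht] at hs
        rw [abs_of_nonpos, neg_pow]
        · ring
        · rw [intervalIntegral.integral_symm]
          exact neg_nonpos.2 (intervalIntegral.integral_nonneg hs.2 fun u _ => ha0 u)
      rw [intervalIntegral.integral_congr this, intervalIntegral.integral_const_mul, abs_mul,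
        abs_neg]
      simp
  rw [key, integral_mul_primitive_pow ha, abs_div, abs_pow,
    abs_of_pos (by positivity : (0 : ℝ) < k + 1)]

theorem norm_picardTerm_le {A : ℝ → Matrix (Fin n) (Fin n) ℂ}
    (hA : ∀ i j a b, IntervalIntegrable (fun t => A t i j) volume a b) (x₀ : Fin n → ℂ) (k : ℕ)
    (t : ℝ) :
    ‖picardTerm A x₀ k t‖ ≤
      |∫ s in (0 : ℝ)..t, ∑ i, ∑ j, ‖A s i j‖| ^ k / k.factorial * ‖x₀‖ := by
  have ha := intervalIntegrable_sum_norm hA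
  induction k generalizing t with
  | zero => simp [picardTerm]
  | succ k ih =>
    set a : ℝ → ℝ := fun s => ∑ i, ∑ j, ‖A s i j‖ with hadef
    have ha0 : ∀ t, 0 ≤ a t := fun t => by positivity
    have hcont : Continuous fun s => |∫ r in (0 : ℝ)..s, a r| ^ k :=
      ((intervalIntegral.continuous_primitive ha 0).abs).pow k
    have hint : IntervalIntegrable
        (fun s => a s * |∫ r in (0 : ℝ)..s, a r| ^ k * (‖x₀‖ / k.factorial)) volume 0 t :=
      ((ha 0 t).mul_continuousOn hcont.continuousOn).mul_const _
    calc ‖picardTerm A x₀ (k + 1) t‖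
        ≤ |∫ s in (0 : ℝ)..t, a s * |∫ r in (0 : ℝ)..s, a r| ^ k * (‖x₀‖ / k.factorial)| := by
          refine intervalIntegral.norm_integral_le_abs_of_norm_le ?_ hint
          refine Filter.Eventually.of_forall fun s => ?_
          refine (norm_mulVec_le_sum_norm_mul _ _).trans ?_
          calc a s * ‖picardTerm A x₀ k s‖
              ≤ a s * (|∫ r in (0 : ℝ)..s, a r| ^ k / k.factorial * ‖x₀‖) :=
                mul_le_mul_of_nonneg_left (ih s) (ha0 s)
            _ = _ := by ring
      _ = |∫ r in (0 : ℝ)..t, a r| ^ (k + 1) / (k + 1) * (‖x₀‖ / k.factorial) := by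
          rw [intervalIntegral.integral_mul_const, abs_mul,
            abs_integral_mul_abs_primitive_pow ha ha0,
            abs_of_nonneg (by positivity : 0 ≤ ‖x₀‖ / k.factorial)]
      _ = _ := by
          rw [Nat.factorial_succ]
          push_cast
          field_simp

/-- The factorial bound makes the Picard series converge uniformly on each `[-R, R]`; dominated
convergence then moves the sum through the integral, which shifts the index of the series by one. -/
theorem exists_integral_equation {A : ℝ → Matrix (Fin n) (Fin n) ℂ}
    (hA : ∀ i j a b, IntervalIntegrable (fun t => A t i j) volume a b) (x₀ : Fin n → ℂ) :
    ∃ x : ℝ → Fin n → ℂ, Continuous x ∧ ∀ t, x t = x₀ + ∫ s in (0 : ℝ)..t, A s *ᵥ x s := by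
  have ha := intervalIntegrable_sum_norm hA
  have hb : ∀ R : ℝ, ∃ B : ℝ, ∀ t ∈ Set.Icc (-R) R,
      |∫ s in (0 : ℝ)..t, ∑ i, ∑ j, ‖A s i j‖| ≤ B := fun R => by
    obtain ⟨B, hB⟩ := isCompact_Icc.exists_bound_of_continuousOn (s := Set.Icc (-R) R)
      (intervalIntegral.continuous_primitive ha 0).continuousOn
    exact ⟨B, fun t ht => by simpa using hB t ht⟩
  choose B hB using hb
  set u : ℝ → ℕ → ℝ := fun R k => |B R| ^ k / k.factorial * ‖x₀‖ with hu
  have hus : ∀ R, Summable (u R) := fun R => (Real.summable_pow_div_factorial |B R|).mul_right _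
  have hbound : ∀ R k, ∀ t ∈ Set.Icc (-R) R, ‖picardTerm A x₀ k t‖ ≤ u R k := fun R k t ht => by
    refine (norm_picardTerm_le hA x₀ k t).trans ?_
    simp only [hu]
    have := (hB R t ht).trans (le_abs_self _)
    exact mul_le_mul_of_nonneg_right (div_le_div_of_nonneg_right
      (pow_le_pow_left₀ (abs_nonneg _) this k) (by positivity)) (norm_nonneg _)
  have hmem : ∀ t : ℝ, t ∈ Set.Icc (-|t|) |t| := fun t => ⟨neg_abs_le t, le_abs_self t⟩
  have hsum : ∀ t, Summable fun k => picardTerm A x₀ k t := fun t =>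
    Summable.of_norm_bounded (hus |t|) fun k => hbound _ k t (hmem t)
  have hcont : Continuous fun t => ∑' k, picardTerm A x₀ k t := by
    rw [continuous_iff_continuousAt]
    intro t
    have h1 : ContinuousOn (fun t => ∑' k, picardTerm A x₀ k t)
        (Set.Icc (-(|t| + 1)) (|t| + 1)) :=
      continuousOn_tsum (fun k => (continuous_picardTerm hA x₀ k).continuousOn) (hus (|t| + 1))
        (fun k s hs => hbound _ k s hs)
    refine h1.continuousAt (Icc_mem_nhds ?_ ?_)
    · linarith [neg_abs_le t]
    · linarith [le_abs_self t]
  refine ⟨_, hcont, fun t => ?_⟩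
  have hmv : ∀ s, A s *ᵥ (∑' k, picardTerm A x₀ k s) = ∑' k, A s *ᵥ picardTerm A x₀ k s := fun s =>
    (LinearMap.toContinuousLinearMap (Matrix.mulVecLin (A s))).map_tsum (hsum s)
  have hI : HasSum (fun k => ∫ s in (0 : ℝ)..t, A s *ᵥ picardTerm A x₀ k s)
      (∫ s in (0 : ℝ)..t, A s *ᵥ (∑' k, picardTerm A x₀ k s)) := by
    refine intervalIntegral.hasSum_integral_of_dominated_convergence
      (fun k s => (∑ i, ∑ j, ‖A s i j‖) * u |t| k) (fun k => ?_) (fun k => ?_) ?_ ?_ ?_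
    · exact (intervalIntegrable_mulVec (fun i j => hA i j 0 t)
        (continuous_picardTerm hA x₀ k).continuousOn).aestronglyMeasurable_restrict_uIoc
    · refine Filter.Eventually.of_forall fun s hs => (norm_mulVec_le_sum_norm_mul _ _).trans ?_
      refine mul_le_mul_of_nonneg_left (hbound _ k s ?_) (by positivity)
      have := Set.uIoc_subset_uIcc hs
      rw [Set.mem_uIcc] at this
      constructor <;> rcases this with h | h <;> linarith [neg_abs_le t, le_abs_self t, abs_nonneg t]
    · exact Filter.Eventually.of_forall fun s _ => (hus |t|).mul_left _
    · simp_rw [tsum_mul_left]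
      exact (ha 0 t).mul_const _
    · refine Filter.Eventually.of_forall fun s _ => ?_
      exact (LinearMap.toContinuousLinearMap (Matrix.mulVecLin (A s))).hasSum (hsum s).hasSum
  rw [(hsum t).tsum_eq_zero_add, ← hI.tsum_eq]
  rfl

theorem isCaratheodorySolution_of_integral_equation {A : ℝ → Matrix (Fin n) (Fin n) ℂ}
    (hA : ∀ i j a b, IntervalIntegrable (fun t => A t i j) volume a b) {x₀ : Fin n → ℂ}
    {x : ℝ → Fin n → ℂ} (hc : Continuous x) (hx : ∀ t, x t = x₀ + ∫ s in (0 : ℝ)..t, A s *ᵥ x s) :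
    IsCaratheodorySolution A x₀ x := by
  have hi : ∀ a b, IntervalIntegrable (fun t => A t *ᵥ x t) volume a b := fun a b =>
    intervalIntegrable_mulVec (fun i j => hA i j a b) hc.continuousOn
  refine ⟨by simpa using hx 0, fun a b => ?_, ?_⟩
  -- The base point `0` of the primitive may lie outside `[a, b]`, so a symmetric interval
  -- containing `0`, `a` and `b` is used first.
  · have h0 : ∀ c : ℝ, |c| ≤ |a| + |b| → c ∈ Set.uIcc (-(|a| + |b|)) (|a| + |b|) := fun c hc => by
      rw [Set.mem_uIcc]
      exact Or.inl (abs_le.1 hc)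
    refine (((hi (-(|a| + |b|)) (|a| + |b|)).absolutelyContinuousOnInterval_integral (c := 0)
      (h0 0 (by rw [abs_zero]; positivity))).of_dist_le fun s _ t _ => ?_).mono (Set.uIcc_subset_uIcc
        (h0 a (by linarith [abs_nonneg b])) (h0 b (by linarith [abs_nonneg a])))
    rw [hx s, hx t, dist_add_left]
  · have hl : LocallyIntegrable (fun t => A t *ᵥ x t) volume := by
      intro t
      refine ⟨Set.Icc (t - 1) (t + 1), Icc_mem_nhds (by linarith) (by linarith), ?_⟩
      exact (intervalIntegrable_iff_integrableOn_Icc_of_le (by linarith)).1 (hi _ _)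
    filter_upwards [LocallyIntegrable.ae_hasDerivAt_integral hl] with t ht
    have := (ht 0).const_add x₀
    exact this.congr_of_eventuallyEq (Filter.Eventually.of_forall hx)

theorem exists_isCaratheodorySolution {A : ℝ → Matrix (Fin n) (Fin n) ℂ}
    (hA : ∀ i j a b, IntervalIntegrable (fun t => A t i j) volume a b) (x₀ : Fin n → ℂ) :
    ∃ x : ℝ → Fin n → ℂ, IsCaratheodorySolution A x₀ x := by
  obtain ⟨x, hc, hx⟩ := exists_integral_equation hA x₀
  exact ⟨x, isCaratheodorySolution_of_integral_equation hA hc hx⟩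

end Caratheodory

/-! ### Adjoint equation, invertibility, uniqueness and variation of constants -/

section StateTransition

variable {n : ℕ}

/-- In the product rule `(-Aᵀ p) ⬝ x` cancels `p ⬝ A x`, so only the forcing term `h` survives. -/
theorem dotProduct_adjoint_solution {A : ℝ → Matrix (Fin n) (Fin n) ℂ} {p₀ : Fin n → ℂ}
    {p x h : ℝ → Fin n → ℂ} {a b : ℝ}
    (hp : IsCaratheodorySolution (fun t => -(A t)ᵀ) p₀ p)
    (hx : AbsolutelyContinuousOnInterval x a b)
    (hd : ∀ᵐ t, t ∈ Set.uIcc a b → HasDerivAt x (A t *ᵥ x t + h t) t) :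
    AbsolutelyContinuousOnInterval (fun t => p t ⬝ᵥ x t) a b ∧
      ∀ᵐ t, t ∈ Set.uIcc a b → HasDerivAt (fun t => p t ⬝ᵥ x t) (p t ⬝ᵥ h t) t := by
  refine ⟨AbsolutelyContinuousOnInterval.finsetSum _ fun i _ =>
    ((hp.2.1 a b).apply i).fun_smul (hx.apply i), ?_⟩
  filter_upwards [hd, hp.2.2] with t h1 h2 ht
  have h3 : HasDerivAt (fun t => p t ⬝ᵥ x t)
      ((-(A t)ᵀ *ᵥ p t) ⬝ᵥ x t + p t ⬝ᵥ (A t *ᵥ x t + h t)) t := by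
    simp only [dotProduct, ← Finset.sum_add_distrib]
    exact HasDerivAt.fun_sum fun i _ =>
      (hasDerivAt_pi.1 h2 i).mul (hasDerivAt_pi.1 (h1 ht) i)
  convert h3 using 1
  rw [Matrix.neg_mulVec, Matrix.mulVec_transpose, neg_dotProduct, dotProduct_add,
    Matrix.dotProduct_mulVec]
  ring

theorem dotProduct_adjoint_solution_eq {A : ℝ → Matrix (Fin n) (Fin n) ℂ} {p₀ x₀ : Fin n → ℂ}
    {p x : ℝ → Fin n → ℂ} (hp : IsCaratheodorySolution (fun t => -(A t)ᵀ) p₀ p)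
    (hx : IsCaratheodorySolution A x₀ x) (t : ℝ) : p t ⬝ᵥ x t = p₀ ⬝ᵥ x₀ := by
  obtain ⟨h1, h2⟩ := dotProduct_adjoint_solution (h := 0) hp (hx.2.1 0 t)
    (by filter_upwards [hx.2.2] with s hs _; simpa using hs)
  have := h1.eq_of_ae_hasDerivAt_zero (by simpa using h2) (Set.right_mem_uIcc)
  rw [this, hp.1, hx.1]

/-- The rows of `Ψ` solve the adjoint equation `ṗ = -Aᵀ p` with initial values `e_i`. -/
def IsAdjointTransitionMatrix (A Ψ : ℝ → Matrix (Fin n) (Fin n) ℂ) : Prop :=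
  ∀ i : Fin n, IsCaratheodorySolution (fun t => -(A t)ᵀ) (Pi.single i 1) fun t => Ψ t i

theorem IsAdjointTransitionMatrix.mulVec_solution {A Ψ : ℝ → Matrix (Fin n) (Fin n) ℂ}
    (hΨ : IsAdjointTransitionMatrix A Ψ) {x₀ : Fin n → ℂ} {x : ℝ → Fin n → ℂ}
    (hx : IsCaratheodorySolution A x₀ x) (t : ℝ) : Ψ t *ᵥ x t = x₀ := by
  funext i
  exact (dotProduct_adjoint_solution_eq (hΨ i) hx t).trans (single_one_dotProduct i x₀)

theorem IsAdjointTransitionMatrix.mul_eq_one {A Ψ Φ : ℝ → Matrix (Fin n) (Fin n) ℂ}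
    (hΨ : IsAdjointTransitionMatrix A Ψ) (hΦ : IsStateTransitionMatrix A Φ) (t : ℝ) :
    Ψ t * Φ t = 1 := by
  ext i j
  have := congrFun (hΨ.mulVec_solution (hΦ j) t) i
  refine (this.trans ?_)
  simp [Pi.single_apply, Matrix.one_apply]

theorem IsAdjointTransitionMatrix.mul_eq_one' {A Ψ Φ : ℝ → Matrix (Fin n) (Fin n) ℂ}
    (hΨ : IsAdjointTransitionMatrix A Ψ) (hΦ : IsStateTransitionMatrix A Φ) (t : ℝ) :
    Φ t * Ψ t = 1 :=
  mul_eq_one_comm.1 (hΨ.mul_eq_one hΦ t)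

/-- The same `Ψ` is a left inverse of every transition matrix, which replaces a Grönwall argument.
-/
theorem IsStateTransitionMatrix.unique {A Ψ Φ Φ' : ℝ → Matrix (Fin n) (Fin n) ℂ}
    (hΨ : IsAdjointTransitionMatrix A Ψ) (hΦ : IsStateTransitionMatrix A Φ)
    (hΦ' : IsStateTransitionMatrix A Φ') : Φ' = Φ := by
  funext t
  rw [← Matrix.one_mul (Φ' t), ← hΨ.mul_eq_one' hΦ t, Matrix.mul_assoc, hΨ.mul_eq_one hΦ',
    Matrix.mul_one]

theorem IsStateTransitionMatrix.apply_zero {A Φ : ℝ → Matrix (Fin n) (Fin n) ℂ}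
    (hΦ : IsStateTransitionMatrix A Φ) : Φ 0 = 1 := by
  ext i j
  refine (congrFun (hΦ j).1 i).trans ?_
  simp [Pi.single_apply, Matrix.one_apply]

theorem exists_isStateTransitionMatrix {A : ℝ → Matrix (Fin n) (Fin n) ℂ}
    (hA : ∀ i j a b, IntervalIntegrable (fun t => A t i j) volume a b) :
    ∃ Φ, IsStateTransitionMatrix A Φ := by
  choose x hx using fun i : Fin n => exists_isCaratheodorySolution hA (Pi.single i 1)
  exact ⟨fun t => Matrix.of fun i j => x j t i, hx⟩

theorem exists_isAdjointTransitionMatrix {A : ℝ → Matrix (Fin n) (Fin n) ℂ}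
    (hA : ∀ i j a b, IntervalIntegrable (fun t => A t i j) volume a b) :
    ∃ Ψ, IsAdjointTransitionMatrix A Ψ := by
  choose x hx using fun i : Fin n => exists_isCaratheodorySolution
    (A := fun t => -(A t)ᵀ) (fun i j a b => (hA j i a b).neg) (Pi.single i 1)
  exact ⟨fun t => Matrix.of fun i j => x i t j, hx⟩

theorem IsCaratheodorySolution.continuous {A : ℝ → Matrix (Fin n) (Fin n) ℂ} {x₀ : Fin n → ℂ}
    {x : ℝ → Fin n → ℂ} (hx : IsCaratheodorySolution A x₀ x) : Continuous x := by
  rw [continuous_iff_continuousAt]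
  intro t
  have h := (hx.2.1 (t - 1) (t + 1)).continuousOn
  rw [Set.uIcc_of_le (by linarith)] at h
  exact h.continuousAt (Icc_mem_nhds (by linarith) (by linarith))

theorem IsStateTransitionMatrix.continuous {A Φ : ℝ → Matrix (Fin n) (Fin n) ℂ}
    (hΦ : IsStateTransitionMatrix A Φ) : Continuous Φ :=
  continuous_matrix fun i j => (continuous_apply i).comp (hΦ j).continuous

theorem IsAdjointTransitionMatrix.continuous {A Ψ : ℝ → Matrix (Fin n) (Fin n) ℂ}
    (hΨ : IsAdjointTransitionMatrix A Ψ) : Continuous Ψ :=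
  continuous_matrix fun i j => (continuous_apply j).comp (hΨ i).continuous

/-- The function `t ↦ e^{-μt} Φ(t) (c - t d)`, which solves `ẋ = A x - μ x - e^{-μt} Φ(t) d`. -/
def shiftedSolution (Φ : ℝ → Matrix (Fin n) (Fin n) ℂ) (μ : ℂ) (c d : Fin n → ℂ) (t : ℝ) :
    Fin n → ℂ :=
  Complex.exp (-(μ * t)) • (Φ t *ᵥ (c - (t : ℂ) • d))

theorem hasDerivAt_exp_mul_ofReal (μ : ℂ) (t : ℝ) :
    HasDerivAt (fun s : ℝ => Complex.exp (μ * s)) (μ * Complex.exp (μ * t)) t := by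
  have h1 : HasDerivAt (fun s : ℝ => μ * (s : ℂ)) μ t := by
    simpa using (Complex.ofRealCLM.hasDerivAt (x := t)).const_mul μ
  simpa [mul_comm] using h1.cexp

theorem contDiff_exp_mul_ofReal (μ : ℂ) :
    ContDiff ℝ 1 (fun s : ℝ => Complex.exp (μ * s)) :=
  (contDiff_const.mul Complex.ofRealCLM.contDiff).cexp

theorem IsStateTransitionMatrix.shiftedSolution {A Φ : ℝ → Matrix (Fin n) (Fin n) ℂ}
    (hΦ : IsStateTransitionMatrix A Φ) (μ : ℂ) (c d : Fin n → ℂ) :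
    (∀ a b, AbsolutelyContinuousOnInterval (shiftedSolution Φ μ c d) a b) ∧
      ∀ᵐ t, HasDerivAt (shiftedSolution Φ μ c d)
        (A t *ᵥ shiftedSolution Φ μ c d t - (μ • shiftedSolution Φ μ c d t +
          shiftedSolution Φ μ d 0 t)) t := by
  -- The equation is known column by column, so the function is expanded along the columns of `Φ`
  -- with smooth scalar coefficients.
  have hexp : ∀ t : ℝ, _root_.shiftedSolution Φ μ c d t =
      ∑ j, (Complex.exp (-μ * t) * (c j - t * d j)) • (Φ t).col j := by
    intro t
    funext i
    simp only [_root_.shiftedSolution, Pi.smul_apply, Matrix.mulVec, dotProduct, smul_eq_mul,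
      Finset.mul_sum,
      Finset.sum_apply, Pi.sub_apply, Matrix.col_apply]
    refine Finset.sum_congr rfl fun j _ => ?_
    rw [neg_mul]
    ring
  have hs : ∀ j, ∀ t : ℝ, HasDerivAt (fun t : ℝ => Complex.exp (-μ * t) * (c j - t * d j))
      (-μ * (Complex.exp (-μ * t) * (c j - t * d j)) - Complex.exp (-μ * t) * d j) t := by
    intro j t
    have h1 : HasDerivAt (fun t : ℝ => c j - (t : ℂ) * d j) (-d j) t := by
      simpa using ((Complex.ofRealCLM.hasDerivAt (x := t)).mul_const (d j)).const_sub (c j)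
    refine ((hasDerivAt_exp_mul_ofReal (-μ) t).fun_mul h1).congr_deriv ?_
    ring
  constructor
  · intro a b
    rw [show _root_.shiftedSolution Φ μ c d = _ from funext hexp]
    refine AbsolutelyContinuousOnInterval.finsetSum _ fun j _ => ?_
    refine AbsolutelyContinuousOnInterval.fun_smul ?_ ((hΦ j).2.1 a b)
    exact ((contDiff_exp_mul_ofReal _).mul
      (contDiff_const.sub (Complex.ofRealCLM.contDiff.mul
        contDiff_const))).absolutelyContinuousOnInterval a b
  · have h : ∀ᵐ t, ∀ j, HasDerivAt (fun t => (Φ t).col j) (A t *ᵥ (Φ t).col j) t :=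
      ae_all_iff.2 fun j => (hΦ j).2.2
    filter_upwards [h] with t ht
    rw [show _root_.shiftedSolution Φ μ c d = _ from funext hexp]
    refine (HasDerivAt.fun_sum fun j (_ : j ∈ Finset.univ) =>
      (hs j t).fun_smul (ht j)).congr_deriv ?_
    have hexp' : _root_.shiftedSolution Φ μ d 0 t =
        ∑ j, (Complex.exp (-μ * t) * d j) • (Φ t).col j := by
      funext i
      simp only [_root_.shiftedSolution, Pi.smul_apply, Matrix.mulVec, dotProduct, smul_eq_mul,
      Finset.mul_sum,
        Finset.sum_apply, smul_zero, sub_zero, Matrix.col_apply]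
      refine Finset.sum_congr rfl fun j _ => ?_
      rw [neg_mul]
      ring
    rw [hexp', Matrix.mulVec_sum, Finset.smul_sum, ← Finset.sum_add_distrib,
      ← Finset.sum_sub_distrib]
    refine Finset.sum_congr rfl fun j _ => ?_
    rw [Matrix.mulVec_smul]
    module

/-- Variation of constants: `Ψ(t) e^{μt} x(t) + t d` has zero derivative almost everywhere, and `Φ`
undoes `Ψ`. -/
theorem eq_shiftedSolution {A Φ Ψ : ℝ → Matrix (Fin n) (Fin n) ℂ}
    (hΨ : IsAdjointTransitionMatrix A Ψ)
    (hΦ : IsStateTransitionMatrix A Φ) (μ : ℂ) (d : Fin n → ℂ) {x : ℝ → Fin n → ℂ} {T t : ℝ}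
    (hx : AbsolutelyContinuousOnInterval x 0 T)
    (hd : ∀ᵐ t, t ∈ Set.uIcc 0 T → HasDerivAt x
      (A t *ᵥ x t - (μ • x t + shiftedSolution Φ μ d 0 t)) t) (ht : t ∈ Set.uIcc 0 T) :
    x t = shiftedSolution Φ μ (x 0) d t := by
  -- The exponential factor absorbs the `μ` term, leaving `ẇ = A w - Φ d`.
  set w : ℝ → Fin n → ℂ := fun t => Complex.exp (μ * t) • x t with hw
  have hwac : AbsolutelyContinuousOnInterval w 0 T :=
    ((contDiff_exp_mul_ofReal μ).absolutelyContinuousOnInterval 0 T).fun_smul hx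
  have hwd : ∀ᵐ t, t ∈ Set.uIcc 0 T → HasDerivAt w (A t *ᵥ w t + -(Φ t *ᵥ d)) t := by
    filter_upwards [hd] with t h1 ht
    refine ((hasDerivAt_exp_mul_ofReal μ t).fun_smul (h1 ht)).congr_deriv ?_
    simp only [hw, Matrix.mulVec_smul, shiftedSolution, smul_zero, sub_zero, smul_sub, smul_add,
      smul_smul, ← Complex.exp_add, add_neg_cancel, Complex.exp_zero, one_smul]
    module
  have hmain : Ψ t *ᵥ w t = x 0 - (t : ℂ) • d := by
    funext i
    obtain ⟨h1, h2⟩ := dotProduct_adjoint_solution (hΨ i) hwac hwd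
    have h3 : AbsolutelyContinuousOnInterval (fun t : ℝ => (t : ℂ) * d i) 0 T :=
      (Complex.ofRealCLM.contDiff.mul contDiff_const).absolutelyContinuousOnInterval 0 T
    have h4 : ∀ᵐ t, t ∈ Set.uIcc 0 T →
        HasDerivAt (fun t : ℝ => Ψ t i ⬝ᵥ w t + (t : ℂ) * d i) 0 t := by
      filter_upwards [h2] with t ht hm
      have h5 : HasDerivAt (fun t : ℝ => (t : ℂ) * d i) (d i) t := by
        simpa using (Complex.ofRealCLM.hasDerivAt (x := t)).mul_const (d i)
      refine ((ht hm).fun_add h5).congr_deriv ?_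
      have : Ψ t i ⬝ᵥ Φ t *ᵥ d = (Ψ t *ᵥ (Φ t *ᵥ d)) i := rfl
      rw [dotProduct_neg, this, Matrix.mulVec_mulVec, hΨ.mul_eq_one hΦ, Matrix.one_mulVec]
      ring
    have h6 := (h1.add h3).eq_of_ae_hasDerivAt_zero h4 ht
    have h7 : Ψ 0 i ⬝ᵥ w 0 = x 0 i := by
      refine (congrArg (· ⬝ᵥ w 0) (hΨ i).1).trans ?_
      simp [hw]
    simp only [Pi.add_apply, h7, Complex.ofReal_zero, zero_mul, add_zero] at h6
    exact eq_sub_of_add_eq h6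
  have h8 : w t = Φ t *ᵥ (x 0 - (t : ℂ) • d) := by
    rw [← hmain, Matrix.mulVec_mulVec, hΨ.mul_eq_one' hΦ, Matrix.one_mulVec]
  rw [shiftedSolution, ← h8, hw]
  simp only [smul_smul, ← Complex.exp_add, neg_add_cancel, Complex.exp_zero, one_smul]

end StateTransition

/-! ### Scalar Fourier coefficients on a period -/

section Phasors

variable {T : ℝ}

/-- The fourierMode `t ↦ e^{jωkt}`, `ω = 2π/T`. -/
def fourierMode (T : ℝ) (k : ℤ) (t : ℝ) : ℂ :=
  Complex.exp (Complex.I * ((2 * Real.pi / T : ℝ) : ℂ) * (k : ℂ) * (t : ℂ))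

theorem phasor_eq_integral_fourierMode (T : ℝ) (a : ℝ → ℂ) (k : ℤ) :
    phasor T a k = (1 / (T : ℂ)) * ∫ t in (0 : ℝ)..T, a t * fourierMode T (-k) t := by
  simp [phasor, fourierMode]

theorem fourierMode_add (T : ℝ) (k l : ℤ) (t : ℝ) :
    fourierMode T (k + l) t = fourierMode T k t * fourierMode T l t := by
  rw [fourierMode, fourierMode, fourierMode, ← Complex.exp_add]
  congr 1
  push_cast
  ring

theorem star_fourierMode (T : ℝ) (k : ℤ) (t : ℝ) : star (fourierMode T k t) = fourierMode T (-k) t := by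
  rw [fourierMode, fourierMode, Complex.star_def, ← Complex.exp_conj]
  simp [map_ofNat]

theorem norm_fourierMode (T : ℝ) (k : ℤ) (t : ℝ) : ‖fourierMode T k t‖ = 1 := by
  rw [fourierMode, show Complex.I * ((2 * Real.pi / T : ℝ) : ℂ) * (k : ℂ) * (t : ℂ) =
    ((2 * Real.pi / T * k * t : ℝ) : ℂ) * Complex.I by push_cast; ring]
  exact Complex.norm_exp_ofReal_mul_I _

theorem fourierMode_zero_left (T t : ℝ) : fourierMode T 0 t = 1 := by simp [fourierMode]

theorem fourierMode_zero_right (T : ℝ) (k : ℤ) : fourierMode T k 0 = 1 := by simp [fourierMode]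

theorem fourierMode_period (hT : 0 < T) (k : ℤ) : fourierMode T k T = 1 := by
  have hT' : (T : ℂ) ≠ 0 := by exact_mod_cast hT.ne'
  rw [fourierMode, show Complex.I * ((2 * Real.pi / T : ℝ) : ℂ) * (k : ℂ) * (T : ℂ) =
    k * (2 * Real.pi * Complex.I) by push_cast; field_simp]
  exact Complex.exp_int_mul_two_pi_mul_I k

theorem contDiff_fourierMode (T : ℝ) (k : ℤ) : ContDiff ℝ 1 (fourierMode T k) :=
  contDiff_exp_mul_ofReal _

theorem hasDerivAt_fourierMode (T : ℝ) (k : ℤ) (t : ℝ) :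
    HasDerivAt (fourierMode T k)
      (Complex.I * ((2 * Real.pi / T : ℝ) : ℂ) * (k : ℂ) * fourierMode T k t) t :=
  hasDerivAt_exp_mul_ofReal _ t

theorem phasor_eq_fourierCoeffOn (hT : 0 < T) (a : ℝ → ℂ) (k : ℤ) :
    phasor T a k = fourierCoeffOn hT a k := by
  rw [fourierCoeffOn_eq_integral, phasor, Complex.real_smul]
  congr 1
  · simp
  refine intervalIntegral.integral_congr fun t _ => ?_
  simp only [fourier_coe_apply, smul_eq_mul]
  rw [mul_comm]
  congr 2
  push_cast
  rw [sub_zero]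
  ring

theorem phasor_congr_ae (hT : 0 < T) {f g : ℝ → ℂ} (h : f =ᵐ[volume.restrict (Set.Ioc 0 T)] g)
    (k : ℤ) : phasor T f k = phasor T g k := by
  rw [phasor_eq_fourierCoeffOn hT, phasor_eq_fourierCoeffOn hT]
  exact congrFun (fourierCoeffOn_congr_ae hT h) k

theorem IntervalIntegrable.mul_fourierMode {f : ℝ → ℂ} {a b : ℝ}
    (hf : IntervalIntegrable f volume a b) (k : ℤ) :
    IntervalIntegrable (fun t => f t * fourierMode T k t) volume a b :=
  hf.mul_continuousOn (contDiff_fourierMode T k).continuous.continuousOn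

theorem phasor_sub {f g : ℝ → ℂ} (hf : IntervalIntegrable f volume 0 T)
    (hg : IntervalIntegrable g volume 0 T) (k : ℤ) :
    phasor T (fun t => f t - g t) k = phasor T f k - phasor T g k := by
  simp only [phasor_eq_integral_fourierMode, sub_mul]
  rw [intervalIntegral.integral_sub (hf.mul_fourierMode _) (hg.mul_fourierMode _), mul_sub]

theorem phasor_const_mul (c : ℂ) (f : ℝ → ℂ) (k : ℤ) :
    phasor T (fun t => c * f t) k = c * phasor T f k := by
  simp only [phasor_eq_integral_fourierMode, mul_assoc, intervalIntegral.integral_const_mul]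
  ring

/-- Integration by parts; the boundary terms cancel because `u` and the Fourier mode both agree at
`0` and `T`. -/
theorem phasor_of_ae_hasDerivAt (hT : 0 < T) {u g : ℝ → ℂ}
    (hu : AbsolutelyContinuousOnInterval u 0 T)
    (hd : ∀ᵐ t, t ∈ Set.uIcc 0 T → HasDerivAt u (g t) t)
    (hg : IntervalIntegrable g volume 0 T) (hper : u T = u 0) (k : ℤ) :
    phasor T g k = Complex.I * ((2 * Real.pi / T : ℝ) : ℂ) * (k : ℂ) * phasor T u k := by
  have hui : IntervalIntegrable u volume 0 T := hu.continuousOn.intervalIntegrable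
  have hac := hu.fun_smul ((contDiff_fourierMode T (-k)).absolutelyContinuousOnInterval 0 T)
  have hd' : ∀ᵐ t, t ∈ Set.uIcc 0 T → HasDerivAt (fun t => u t • fourierMode T (-k) t)
      (g t * fourierMode T (-k) t - Complex.I * ((2 * Real.pi / T : ℝ) : ℂ) * (k : ℂ) *
        (u t * fourierMode T (-k) t)) t := by
    filter_upwards [hd] with t h1 ht
    refine ((h1 ht).fun_mul (hasDerivAt_fourierMode T (-k) t)).congr_deriv ?_
    push_cast
    ring
  have h2 := hac.integral_eq_sub_of_ae_hasDerivAt hd'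
    ((hg.mul_fourierMode _).sub ((hui.mul_fourierMode _).const_mul _))
  rw [intervalIntegral.integral_sub (hg.mul_fourierMode _) ((hui.mul_fourierMode _).const_mul _),
    intervalIntegral.integral_const_mul, fourierMode_period hT, fourierMode_zero_right, hper,
    sub_self, sub_eq_zero] at h2
  rw [phasor_eq_integral_fourierMode, phasor_eq_integral_fourierMode, h2]
  ring

theorem phasor_fourierMode (hT : 0 < T) (l k : ℤ) :
    phasor T (fourierMode T l) k = if k = l then 1 else 0 := by
  have hT' : (T : ℂ) ≠ 0 := by exact_mod_cast hT.ne'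
  split_ifs with h
  · subst h
    have : ∀ t, fourierMode T k t * fourierMode T (-k) t = 1 := fun t => by
      rw [← fourierMode_add, add_neg_cancel, fourierMode_zero_left]
    simp [phasor_eq_integral_fourierMode, this, hT']
  · have h1 := phasor_of_ae_hasDerivAt hT
      ((contDiff_fourierMode T l).absolutelyContinuousOnInterval 0 T)
      (Filter.Eventually.of_forall fun t _ => hasDerivAt_fourierMode T l t)
      ((continuous_const.mul (contDiff_fourierMode T l).continuous).intervalIntegrable 0 T)
      -- Differentiating the mode multiplies its `k`-th phasor by both `jωl` and `jωk`, so it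
      -- vanishes for `k ≠ l`.
      (by rw [fourierMode_period hT, fourierMode_zero_right]) k
    rw [phasor_const_mul, ← sub_eq_zero, ← sub_mul, ← mul_sub] at h1
    refine (mul_eq_zero.1 h1).resolve_left (mul_ne_zero (mul_ne_zero Complex.I_ne_zero ?_) ?_)
    · exact_mod_cast (by positivity : 2 * Real.pi / T ≠ 0)
    · rw [sub_ne_zero]
      exact_mod_cast Ne.symm h

theorem ae_eq_zero_of_phasor_eq_zero (hT : 0 < T) {f : ℝ → ℂ}
    (hf : MemLp f 2 (volume.restrict (Set.Ioc 0 T))) (h : ∀ k, phasor T f k = 0) :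
    f =ᵐ[volume.restrict (Set.Ioc 0 T)] 0 := by
  have h1 := hasSum_sq_fourierCoeffOn hT hf
  simp only [← phasor_eq_fourierCoeffOn hT, h] at h1
  have h2 : ∫ t in Set.Ioc 0 T, ‖f t‖ ^ 2 = 0 := by
    have h0 : HasSum (fun _ : ℤ => ‖(0 : ℂ)‖ ^ 2) 0 := by
      simp only [norm_zero, ne_eq, OfNat.ofNat_ne_zero, not_false_eq_true, zero_pow]
      exact hasSum_zero
    have := h1.unique h0
    rw [smul_eq_mul, sub_zero, mul_eq_zero, intervalIntegral.integral_of_le hT.le] at this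
    exact this.resolve_left (inv_ne_zero hT.ne')
  rw [integral_eq_zero_iff_of_nonneg (fun t => by positivity)
    (hf.integrable_norm_pow (by norm_num))] at h2
  filter_upwards [h2] with t ht
  simpa using ht

theorem intervalIntegrable_of_memLp_two (hT : 0 < T) {f : ℝ → ℂ}
    (hf : MemLp f 2 (volume.restrict (Set.Ioc 0 T))) : IntervalIntegrable f volume 0 T :=
  (intervalIntegrable_iff_integrableOn_Ioc_of_le hT.le).2 (hf.integrable (by norm_num))

theorem memLp_of_continuousOn (hT : 0 < T) {F : Type*} [NormedAddCommGroup F] {f : ℝ → F}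
    (hf : ContinuousOn f (Set.uIcc 0 T)) (p : ENNReal) :
    MemLp f p (volume.restrict (Set.Ioc 0 T)) := by
  rw [Set.uIcc_of_le hT.le] at hf
  obtain ⟨C, hC⟩ := isCompact_Icc.exists_bound_of_continuousOn hf
  refine (memLp_top_of_bound ?_ C ?_).mono_exponent le_top
  · exact (hf.mono Set.Ioc_subset_Icc_self).aestronglyMeasurable measurableSet_Ioc
  · exact (ae_restrict_mem measurableSet_Ioc).mono fun t ht => hC t (Set.Ioc_subset_Icc_self ht)

/-- The case `k = 0` says that `g` has mean zero, so its primitive `G` takes equal values at `0` and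
`T` and obeys the derivative rule. Then `u - G` has no nonzero-index phasor and is constant by
Parseval. This is what gives elements of the maximal domain an absolutely continuous representative.
-/
theorem exists_ae_eq_primitive_of_phasor (hT : 0 < T) {u g : ℝ → ℂ}
    (hu : MemLp u 2 (volume.restrict (Set.Ioc 0 T))) (hg : IntervalIntegrable g volume 0 T)
    (h : ∀ k : ℤ, phasor T g k = Complex.I * ((2 * Real.pi / T : ℝ) : ℂ) * (k : ℂ) * phasor T u k) :
    (∃ c, u =ᵐ[volume.restrict (Set.Ioc 0 T)] fun t => c + ∫ s in (0 : ℝ)..t, g s) ∧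
      ∫ s in (0 : ℝ)..T, g s = 0 := by
  have hT' : (T : ℂ) ≠ 0 := by exact_mod_cast hT.ne'
  have h0 : ∫ s in (0 : ℝ)..T, g s = 0 := by
    have := h 0
    simpa [phasor_eq_integral_fourierMode, fourierMode_zero_left, hT'] using this
  refine ⟨?_, h0⟩
  set G : ℝ → ℂ := fun t => ∫ s in (0 : ℝ)..t, g s with hG
  have hGac : AbsolutelyContinuousOnInterval G 0 T :=
    hg.absolutelyContinuousOnInterval_integral (by simp)
  have hGi : IntervalIntegrable G volume 0 T := hGac.continuousOn.intervalIntegrable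
  have hui := intervalIntegrable_of_memLp_two hT hu
  have hGp := phasor_of_ae_hasDerivAt hT hGac
    (by filter_upwards [hg.ae_hasDerivAt_integral] with t ht hm using ht hm 0 (by simp)) hg
    (by simp [hG, h0])
  set c := phasor T (fun t => u t - G t) 0 with hc
  have hz : ∀ k, phasor T (fun t => (u t - G t) - c) k = 0 := by
    intro k
    have hck : phasor T (fun _ => c) k = if k = 0 then c else 0 := by
      have := phasor_const_mul (T := T) c (fourierMode T 0) k
      simpa [phasor_fourierMode hT, fourierMode_zero_left] using this
    rw [phasor_sub (hui.sub hGi) intervalIntegrable_const, hck]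
    split_ifs with hk
    · rw [hk, ← hc, sub_self]
    · rw [sub_zero, phasor_sub hui hGi]
      have h1 := (h k).symm.trans (hGp k)
      rw [← sub_eq_zero, ← mul_sub] at h1
      refine (mul_eq_zero.1 h1).resolve_left (mul_ne_zero (mul_ne_zero Complex.I_ne_zero ?_) ?_)
      · exact_mod_cast (by positivity : 2 * Real.pi / T ≠ 0)
      · exact_mod_cast hk
  have hmem : MemLp (fun t => (u t - G t) - c) 2 (volume.restrict (Set.Ioc 0 T)) :=
    (hu.sub (memLp_of_continuousOn hT hGac.continuousOn 2)).sub
      (memLp_of_continuousOn hT continuousOn_const 2)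
  refine ⟨c, ?_⟩
  filter_upwards [ae_eq_zero_of_phasor_eq_zero hT hmem hz] with t ht
  rw [Pi.zero_apply, sub_sub, sub_eq_zero] at ht
  rw [ht, add_comm]

end Phasors

/-! ### The Fourier basis of vector-valued functions -/

section VectorFourier

variable {n : ℕ} {T : ℝ}

/-- Lebesgue measure on a period `(0, T]`, normalised to a probability measure. -/
def periodMeasure (T : ℝ) : Measure ℝ :=
  ENNReal.ofReal (1 / T) • volume.restrict (Set.Ioc 0 T)

theorem memLp_periodMeasure (hT : 0 < T) {F : Type*} [NormedAddCommGroup F] {f : ℝ → F}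
    {p : ENNReal} : MemLp f p (periodMeasure T) ↔ MemLp f p (volume.restrict (Set.Ioc 0 T)) := by
  have h0 : ENNReal.ofReal (1 / T) ≠ 0 := by simpa using hT
  have h1 : volume.restrict (Set.Ioc 0 T) = (ENNReal.ofReal (1 / T))⁻¹ • periodMeasure T := by
    rw [periodMeasure, smul_smul, ENNReal.inv_mul_cancel h0 ENNReal.ofReal_ne_top, one_smul]
  refine ⟨fun h => ?_, fun h => h.smul_measure ENNReal.ofReal_ne_top⟩
  rw [h1]
  exact h.smul_measure (ENNReal.inv_ne_top.2 h0)

theorem ae_periodMeasure (hT : 0 < T) :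
    ae (periodMeasure T) = ae (volume.restrict (Set.Ioc 0 T)) := by
  exact Measure.ae_ennreal_smul_measure_eq (by simpa using hT) _

theorem phasor_eq_integral_periodMeasure (hT : 0 < T) (a : ℝ → ℂ) (k : ℤ) :
    phasor T a k = ∫ t, a t * fourierMode T (-k) t ∂periodMeasure T := by
  rw [phasor_eq_integral_fourierMode, periodMeasure, integral_smul_measure,
    intervalIntegral.integral_of_le hT.le, ENNReal.toReal_ofReal (by positivity), Complex.real_smul]
  push_cast
  rfl

/-- The Hilbert space of square-integrable `ℂⁿ`-valued functions on a period. -/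
abbrev PeriodL2 (n : ℕ) (T : ℝ) : Type := Lp (EuclideanSpace ℂ (Fin n)) 2 (periodMeasure T)

theorem memLp_euclidean (hT : 0 < T) {x : ℝ → Fin n → ℂ}
    (hx : ∀ i, MemLp (fun t => x t i) 2 (volume.restrict (Set.Ioc 0 T))) :
    MemLp (fun t => WithLp.toLp 2 (x t)) 2 (periodMeasure T) := by
  exact MemLp.of_eval_piLp fun i => (memLp_periodMeasure hT).2 (hx i)

theorem memLp_apply (hT : 0 < T) (x : PeriodL2 n T) (i : Fin n) :
    MemLp (fun t => x t i) 2 (volume.restrict (Set.Ioc 0 T)) := by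
  rw [← memLp_periodMeasure hT]
  exact (Lp.memLp x).eval_piLp i

/-- The vector-valued Fourier mode `t ↦ e^{jωkt} e_i`. -/
def vectorMode (T : ℝ) (r : Fin n × ℤ) (t : ℝ) : Fin n → ℂ :=
  Pi.single r.1 (fourierMode T r.2 t)

theorem memLp_vectorMode (hT : 0 < T) (r : Fin n × ℤ) :
    MemLp (fun t => WithLp.toLp 2 (vectorMode T r t)) 2 (periodMeasure T) := by
  refine memLp_euclidean hT fun i => memLp_of_continuousOn hT (Continuous.continuousOn ?_) 2
  simp only [vectorMode, Pi.single_apply]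
  split_ifs
  · exact (contDiff_fourierMode T r.2).continuous
  · exact continuous_const

theorem inner_vectorMode (hT : 0 < T) (r : Fin n × ℤ) {x : ℝ → Fin n → ℂ}
    (hx : MemLp (fun t => WithLp.toLp 2 (x t)) 2 (periodMeasure T)) :
    inner ℂ (memLp_vectorMode hT r).toLp hx.toLp = phasor T (fun t => x t r.1) r.2 := by
  rw [L2.inner_def, phasor_eq_integral_periodMeasure hT]
  refine integral_congr_ae ?_
  filter_upwards [(memLp_vectorMode hT r).coeFn_toLp, hx.coeFn_toLp] with t h1 h2
  rw [h1, h2, ← star_fourierMode, mul_comm]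
  exact EuclideanSpace.inner_single_left r.1 (fourierMode T r.2 t) (WithLp.toLp 2 (x t))

theorem orthonormal_vectorMode (hT : 0 < T) :
    Orthonormal ℂ (fun r : Fin n × ℤ => (memLp_vectorMode hT r).toLp) := by
  rw [orthonormal_iff_ite]
  intro r s
  rw [inner_vectorMode hT]
  simp only [vectorMode, Pi.single_apply]
  by_cases h : r.1 = s.1
  · simp only [h, if_true]
    rw [show (fun t => fourierMode T s.2 t) = fourierMode T s.2 from rfl, phasor_fourierMode hT]
    simp [Prod.ext_iff, h]
  · simp [h, Prod.ext_iff, phasor]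

/-- The Fourier basis of `L²((0, T]; ℂⁿ)`. -/
def vectorFourierBasis (n : ℕ) (hT : 0 < T) : HilbertBasis (Fin n × ℤ) ℂ (PeriodL2 n T) :=
  HilbertBasis.mkOfOrthogonalEqBot (orthonormal_vectorMode hT) (by
    rw [Submodule.eq_bot_iff]
    intro f hf
    rw [Lp.eq_zero_iff_ae_eq_zero]
    have h : ∀ i, (fun t => f t i) =ᵐ[volume.restrict (Set.Ioc 0 T)] 0 := fun i =>
      ae_eq_zero_of_phasor_eq_zero hT (memLp_apply hT f i) fun k => by
        have h1 := Submodule.mem_orthogonal _ _ |>.1 hf _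
          (Submodule.subset_span (Set.mem_range_self (i, k)))
        rw [← inner_vectorMode hT (i, k) (x := fun t => f t) (Lp.memLp f), ← h1]
        congr 1
        exact Lp.toLp_coeFn f _
    simp only [Filter.EventuallyEq, ← ae_periodMeasure hT] at h
    filter_upwards [ae_all_iff.2 h] with t ht
    ext i
    simpa using ht i)

theorem coe_vectorFourierBasis (hT : 0 < T) (r : Fin n × ℤ) :
    vectorFourierBasis n hT r = (memLp_vectorMode hT r).toLp :=
  congrFun (HilbertBasis.coe_mkOfOrthogonalEqBot _ _) r

theorem vectorFourierBasis_repr_toLp (hT : 0 < T) (r : Fin n × ℤ) {x : ℝ → Fin n → ℂ}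
    (hx : MemLp (fun t => WithLp.toLp 2 (x t)) 2 (periodMeasure T)) :
    (vectorFourierBasis n hT).repr (hx.toLp) r = phasor T (fun t => x t r.1) r.2 := by
  rw [HilbertBasis.repr_apply_apply, coe_vectorFourierBasis, inner_vectorMode hT]

theorem vectorFourierBasis_repr (hT : 0 < T) (r : Fin n × ℤ) (x : PeriodL2 n T) :
    (vectorFourierBasis n hT).repr x r = phasor T (fun t => x t r.1) r.2 := by
  have := vectorFourierBasis_repr_toLp hT r (x := fun t => x t) (Lp.memLp x)
  rwa [Lp.toLp_coeFn] at this

end VectorFourier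

/-! ### The harmonic state operator as a differential operator -/

section HarmonicOperator

variable {n : ℕ} {T : ℝ} {A : ℝ → Matrix (Fin n) (Fin n) ℂ}

/-- Pairing with this conjugated, modulated row of `A` produces the phasor of `(A x)_i`. -/
theorem memLp_row (hT : 0 < T)
    (hA : ∀ i j, MemLp (fun t => A t i j) 2 (volume.restrict (Set.Ioc 0 T))) (r : Fin n × ℤ) :
    MemLp (fun t => WithLp.toLp 2 fun j => star (A t r.1 j) * fourierMode T r.2 t) 2
      (periodMeasure T) := by
  refine memLp_euclidean hT fun j => ?_
  have h1 : MemLp (fun t => star (A t r.1 j)) 2 (volume.restrict (Set.Ioc 0 T)) := (hA r.1 j).star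
  refine h1.of_le (h1.1.mul (contDiff_fourierMode T r.2).continuous.aestronglyMeasurable)
    (Filter.Eventually.of_forall fun t => ?_)
  rw [norm_mul, norm_fourierMode, mul_one]

theorem inner_row (hT : 0 < T)
    (hA : ∀ i j, MemLp (fun t => A t i j) 2 (volume.restrict (Set.Ioc 0 T))) (r : Fin n × ℤ)
    (x : PeriodL2 n T) :
    inner ℂ (memLp_row hT hA r).toLp x = phasor T (fun t => (A t *ᵥ x t) r.1) r.2 := by
  rw [L2.inner_def, phasor_eq_integral_periodMeasure hT]
  refine integral_congr_ae ?_
  filter_upwards [(memLp_row hT hA r).coeFn_toLp] with t h1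
  rw [h1, PiLp.inner_apply, Matrix.mulVec, dotProduct, Finset.sum_mul]
  refine Finset.sum_congr rfl fun j _ => ?_
  simp only [RCLike.inner_apply, ← star_fourierMode]
  simp
  ring

/-- Parseval for the inner product of the modulated row with `x`: the coefficient of the row along
the mode `(j, p)` is the phasor of `a_{ij}` of index `k - p`. -/
theorem hasSum_blockToeplitz (hT : 0 < T)
    (hA : ∀ i j, MemLp (fun t => A t i j) 2 (volume.restrict (Set.Ioc 0 T))) (r : Fin n × ℤ)
    (x : PeriodL2 n T) :
    HasSum (fun s => blockToeplitz T A r s * (vectorFourierBasis n hT).repr x s)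
      (phasor T (fun t => (A t *ᵥ x t) r.1) r.2) := by
  have h := (vectorFourierBasis n hT).hasSum_inner_mul_inner (memLp_row hT hA r).toLp x
  rw [inner_row hT hA] at h
  refine Eq.mp (congrArg (HasSum · _) (funext fun s => ?_)) h
  simp only
  rw [HilbertBasis.repr_apply_apply, inner_row hT hA, coe_vectorFourierBasis]
  refine congrArg (· * _) ?_
  have h1 : (fun t => (A t *ᵥ ((memLp_vectorMode hT s).toLp _ : PeriodL2 n T) t) r.1)
      =ᵐ[volume.restrict (Set.Ioc 0 T)] fun t => A t r.1 s.1 * fourierMode T s.2 t := by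
    have h2 := (memLp_vectorMode hT s).coeFn_toLp
    rw [Filter.EventuallyEq, ae_periodMeasure hT] at h2
    filter_upwards [h2] with t ht
    rw [ht]
    simp [vectorMode, Matrix.mulVec_single]
  rw [phasor_congr_ae hT h1, blockToeplitz, Matrix.of_apply, phasor_eq_integral_fourierMode,
    phasor_eq_integral_fourierMode]
  congr 2
  funext t
  rw [mul_assoc, ← fourierMode_add]
  congr 2
  ring

theorem hasSum_harmonicState (hT : 0 < T)
    (hA : ∀ i j, MemLp (fun t => A t i j) 2 (volume.restrict (Set.Ioc 0 T))) (r : Fin n × ℤ)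
    (x : PeriodL2 n T) :
    HasSum (fun s => (blockToeplitz T A - harmonicDiagonal n T) r s *
        (vectorFourierBasis n hT).repr x s)
      (phasor T (fun t => (A t *ᵥ x t) r.1) r.2 -
        Complex.I * ((2 * Real.pi / T : ℝ) : ℂ) * (r.2 : ℂ) * phasor T (fun t => x t r.1) r.2) := by
  simp only [Matrix.sub_apply, sub_mul]
  refine (hasSum_blockToeplitz hT hA r x).sub ?_
  rw [← vectorFourierBasis_repr hT r x]
  have h := hasSum_single r (f := fun s => harmonicDiagonal n T r s *
    (vectorFourierBasis n hT).repr x s) fun s hs => by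
      simp [harmonicDiagonal, Matrix.diagonal_apply_ne _ hs.symm]
  rwa [show harmonicDiagonal n T r r = Complex.I * ((2 * Real.pi / T : ℝ) : ℂ) * (r.2 : ℂ) from
    Matrix.diagonal_apply_eq _ r] at h

theorem mulVec_apply_intervalIntegrable (hT : 0 < T)
    (hA : ∀ i j, MemLp (fun t => A t i j) 2 (volume.restrict (Set.Ioc 0 T)))
    {x : ℝ → Fin n → ℂ} (hx : ∀ i, MemLp (fun t => x t i) 2 (volume.restrict (Set.Ioc 0 T)))
    (i : Fin n) : IntervalIntegrable (fun t => (A t *ᵥ x t) i) volume 0 T := by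
  rw [intervalIntegrable_iff_integrableOn_Ioc_of_le hT.le]
  exact integrable_finsetSum Finset.univ (f := fun j t => A t i j * x t j)
    fun j _ => (hA i j).integrable_mul (hx j)

/-- A periodic Carathéodory solution of `ẋ = A x - z` on a period gives `(𝒜 - 𝒩) X = Z`. -/
theorem harmonicStateOperator_of_solution (hT : 0 < T)
    (hA : ∀ i j, MemLp (fun t => A t i j) 2 (volume.restrict (Set.Ioc 0 T)))
    {x z : ℝ → Fin n → ℂ} (hx : AbsolutelyContinuousOnInterval x 0 T)
    (hd : ∀ᵐ t, t ∈ Set.uIcc 0 T → HasDerivAt x (A t *ᵥ x t - z t) t) (hper : x T = x 0)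
    (hxL : MemLp (fun t => WithLp.toLp 2 (x t)) 2 (periodMeasure T))
    (hzL : MemLp (fun t => WithLp.toLp 2 (z t)) 2 (periodMeasure T)) :
    ∃ h : (vectorFourierBasis n hT).repr hxL.toLp ∈ (harmonicStateOperator T A).domain,
      harmonicStateOperator T A ⟨_, h⟩ = (vectorFourierBasis n hT).repr hzL.toLp := by
  have hxi : ∀ i, MemLp (fun t => x t i) 2 (volume.restrict (Set.Ioc 0 T)) := fun i =>
    (memLp_periodMeasure hT).1 (hxL.eval_piLp i)
  have hzi : ∀ i, MemLp (fun t => z t i) 2 (volume.restrict (Set.Ioc 0 T)) := fun i =>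
    (memLp_periodMeasure hT).1 (hzL.eval_piLp i)
  have hcoe := hxL.coeFn_toLp
  rw [Filter.EventuallyEq, ae_periodMeasure hT] at hcoe
  have hrow : ∀ r : Fin n × ℤ, HasSum (fun s => (blockToeplitz T A - harmonicDiagonal n T) r s *
        (vectorFourierBasis n hT).repr hxL.toLp s)
      ((vectorFourierBasis n hT).repr hzL.toLp r) := by
    intro r
    convert hasSum_harmonicState hT hA r hxL.toLp using 1
    have h1 := phasor_of_ae_hasDerivAt hT (hx.apply r.1)
      (g := fun t => (A t *ᵥ x t) r.1 - z t r.1)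
      (by filter_upwards [hd] with t h1 ht using hasDerivAt_pi.1 (h1 ht) r.1)
      ((mulVec_apply_intervalIntegrable hT hA hxi r.1).sub
        (intervalIntegrable_of_memLp_two hT (hzi r.1))) (congrFun hper r.1) r.2
    rw [phasor_sub (mulVec_apply_intervalIntegrable hT hA hxi r.1)
      (intervalIntegrable_of_memLp_two hT (hzi r.1))] at h1
    rw [vectorFourierBasis_repr_toLp]
    rw [phasor_congr_ae hT (f := fun t => (A t *ᵥ (hxL.toLp) t) r.1)
      (g := fun t => (A t *ᵥ x t) r.1)
      (by filter_upwards [hcoe] with t ht; rw [ht]),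
      phasor_congr_ae hT (f := fun t => (hxL.toLp) t r.1) (g := fun t => x t r.1)
      (by filter_upwards [hcoe] with t ht; rw [ht]), ← h1]
    ring
  refine ⟨⟨fun r => (hrow r).summable, ?_⟩, ?_⟩
  · simp only [fun r => (hrow r).tsum_eq]
    exact lp.memℓp _
  · ext r
    exact (hrow r).tsum_eq

/-- Every element of the domain of `𝒜 - 𝒩` consists of the phasors of a periodic Carathéodory
solution of `ẋ = A x - z`, where `z` has phasors `(𝒜 - 𝒩) X`. -/
theorem exists_solution_of_mem_domain (hT : 0 < T)
    (hA : ∀ i j, MemLp (fun t => A t i j) 2 (volume.restrict (Set.Ioc 0 T)))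
    {X : EllTwo (Fin n × ℤ)} (hX : X ∈ (harmonicStateOperator T A).domain) :
    ∃ x : ℝ → Fin n → ℂ, AbsolutelyContinuousOnInterval x 0 T ∧ x T = x 0 ∧
      (∃ hxL : MemLp (fun t => WithLp.toLp 2 (x t)) 2 (periodMeasure T),
        (vectorFourierBasis n hT).repr hxL.toLp = X) ∧
      ∀ z : ℝ → Fin n → ℂ, ∀ hzL : MemLp (fun t => WithLp.toLp 2 (z t)) 2 (periodMeasure T),
        (vectorFourierBasis n hT).repr hzL.toLp = harmonicStateOperator T A ⟨X, hX⟩ →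
        ∀ᵐ t, t ∈ Set.uIcc 0 T → HasDerivAt x (A t *ᵥ x t - z t) t := by
  set u : PeriodL2 n T := (vectorFourierBasis n hT).repr.symm X with hu
  set v : PeriodL2 n T := (vectorFourierBasis n hT).repr.symm
    (harmonicStateOperator T A ⟨X, hX⟩) with hv
  have hXu : (vectorFourierBasis n hT).repr u = X := by simp [hu]
  have hrow : ∀ r : Fin n × ℤ, phasor T (fun t => v t r.1) r.2 =
      phasor T (fun t => (A t *ᵥ u t) r.1) r.2 -
        Complex.I * ((2 * Real.pi / T : ℝ) : ℂ) * (r.2 : ℂ) * phasor T (fun t => u t r.1) r.2 := by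
    intro r
    rw [← (hasSum_harmonicState hT hA r u).tsum_eq, hXu, ← vectorFourierBasis_repr hT r v, hv,
      LinearIsometryEquiv.apply_symm_apply]
    rfl
  have huL := memLp_apply hT u
  have hvL := memLp_apply hT v
  have hAi := fun i => mulVec_apply_intervalIntegrable hT hA (x := fun t => u t) huL i
  -- This is the candidate for `ẋ`: the row identities say that its phasors are `jωk` times those of
  -- `u`.
  set g : ℝ → Fin n → ℂ := fun t => A t *ᵥ u t - v t with hg
  have hgi : ∀ i, IntervalIntegrable (fun t => g t i) volume 0 T := fun i =>
    (hAi i).sub (intervalIntegrable_of_memLp_two hT (hvL i))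
  have hprim := fun i => exists_ae_eq_primitive_of_phasor hT (huL i) (hgi i) fun k => by
    have h1 := phasor_sub (hAi i) (intervalIntegrable_of_memLp_two hT (hvL i)) k
    have h2 := hrow (i, k)
    simp only at h2
    rw [h2, sub_sub_cancel] at h1
    exact h1
  choose hc h0 using hprim
  choose c hc using hc
  set x : ℝ → Fin n → ℂ := fun t => c + ∫ s in (0 : ℝ)..t, g s with hxdef
  have hgI : IntervalIntegrable g volume 0 T := intervalIntegrable_pi hgi
  have hac : AbsolutelyContinuousOnInterval x 0 T :=
    (hgI.absolutelyContinuousOnInterval_integral (c := 0) (by simp)).of_dist_le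
      fun s _ t _ => by rw [hxdef]; simp only [dist_add_left]; exact le_rfl
  have hux : ∀ᵐ t ∂volume.restrict (Set.Ioc 0 T), u t = WithLp.toLp 2 (x t) := by
    filter_upwards [ae_all_iff.2 hc, ae_restrict_mem measurableSet_Ioc] with t ht htm
    ext i
    rw [ht i]
    simp only [hxdef, Pi.add_apply]
    rw [intervalIntegral_apply]
    exact hgI.mono_set (Set.uIcc_subset_uIcc_left
      (by rw [Set.uIcc_of_le hT.le]; exact Set.Ioc_subset_Icc_self htm))
  have hxL : MemLp (fun t => WithLp.toLp 2 (x t)) 2 (periodMeasure T) := by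
    refine (memLp_congr_ae ?_).1 (Lp.memLp u)
    rw [Filter.EventuallyEq, ae_periodMeasure hT]
    exact hux
  refine ⟨x, hac, ?_, ⟨hxL, ?_⟩, ?_⟩
  · funext i
    simp only [hxdef, Pi.add_apply]
    rw [intervalIntegral_apply hgI, h0 i]
    simp
  · rw [← hXu]
    congr 1
    refine Lp.ext (hxL.coeFn_toLp.trans ?_)
    rw [Filter.EventuallyEq, ae_periodMeasure hT]
    filter_upwards [hux] with t ht using ht.symm
  · intro z hzL hz
    have hvz : v = hzL.toLp := by rw [hv, ← hz, LinearIsometryEquiv.symm_apply_apply]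
    have hzc := hzL.coeFn_toLp
    rw [← hvz, Filter.EventuallyEq, ae_periodMeasure hT] at hzc
    -- The `L²` identifications hold on `(0, T]`, whereas the claim is on `[0, T]`.
    have hne : ∀ᵐ t : ℝ, t ≠ 0 := by simp [ae_iff, measure_singleton]
    filter_upwards [hgI.ae_hasDerivAt_integral, (ae_restrict_iff' measurableSet_Ioc).1 hzc,
      (ae_restrict_iff' measurableSet_Ioc).1 hux, hne] with t h1 h2 h3 h4 ht
    have h5 := (h1 ht 0 (by simp)).const_add c
    have htm : t ∈ Set.Ioc 0 T := by
      rw [Set.uIcc_of_le hT.le] at ht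
      exact ⟨lt_of_le_of_ne ht.1 h4.symm, ht.2⟩
    simpa only [hg, h2 htm, h3 htm] using h5

end HarmonicOperator

/-! ### Non-defective matrices and Jordan chains -/

section LinearAlgebra

variable {n : ℕ} {M : Matrix (Fin n) (Fin n) ℂ}

/-- In eigenbasis coordinates, `(m i - μ) c_i = d_i` and `(m i - μ) d_i = 0`, which forces `d_i =
0`. -/
theorem MatrixNonDefective.eq_zero_of_jordan_chain (hM : MatrixNonDefective M) {μ : ℂ}
    {c d : Fin n → ℂ} (hc : M *ᵥ c = μ • c + d) (hd : M *ᵥ d = μ • d) : d = 0 := by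
  obtain ⟨b, hb⟩ := hM
  choose m hm using hb
  have hcoord : ∀ i v, b.repr (M *ᵥ v) i = m i * b.repr v i := by
    intro i v
    have : b.coord i ∘ₗ Matrix.toLin' M = m i • b.coord i := by
      refine b.ext fun j => ?_
      rw [LinearMap.comp_apply, (hm j).apply_eq_smul]
      by_cases h : j = i
      · subst h; simp
      · simp [h]
    simpa using LinearMap.congr_fun this v
  refine b.repr.map_eq_zero_iff.1 (Finsupp.ext fun i => ?_)
  have h1 := hcoord i c
  have h2 := hcoord i d
  rw [hc] at h1
  rw [hd] at h2
  simp only [map_add, map_smul, Finsupp.add_apply, Finsupp.smul_apply, smul_eq_mul] at h1 h2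
  rw [Finsupp.zero_apply]
  rcases eq_or_ne μ (m i) with h | h
  · rw [h] at h1
    simpa using h1
  · by_contra h0
    exact h (mul_right_cancel₀ h0 h2)

theorem matrixNonDefective_of_span_eq_top
    (h : Submodule.span ℂ {v : Fin n → ℂ | ∃ μ : ℂ, Module.End.HasEigenvector (Matrix.toLin' M) μ v}
      = ⊤) : MatrixNonDefective M := by
  obtain ⟨s, hs, hspan, hli⟩ := exists_linearIndependent ℂ
    {v : Fin n → ℂ | ∃ μ : ℂ, Module.End.HasEigenvector (Matrix.toLin' M) μ v}
  let b : Module.Basis s ℂ (Fin n → ℂ) := Module.Basis.mk hli (by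
    rw [Subtype.range_coe_subtype, Set.ofPred_mem_eq, hspan, h])
  refine ⟨b.reindex ((Pi.basisFun ℂ (Fin n)).indexEquiv b).symm, fun i => ?_⟩
  rw [Module.Basis.reindex_apply, Module.Basis.mk_apply]
  exact hs (Subtype.coe_prop _)

/-- Without chains of length two, generalized eigenvectors of any order collapse to eigenvectors,
and over `ℂ` the generalized ones span. -/
theorem matrixNonDefective_of_jordan_chain
    (h : ∀ (μ : ℂ) (c d : Fin n → ℂ), M *ᵥ c = μ • c + d → M *ᵥ d = μ • d → d = 0) :
    MatrixNonDefective M := by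
  refine matrixNonDefective_of_span_eq_top (top_le_iff.1 ?_)
  rw [← Module.End.iSup_maxGenEigenspace_eq_top (Matrix.toLin' M)]
  refine iSup_le fun μ v hv => ?_
  obtain ⟨k, hk⟩ := (Module.End.mem_maxGenEigenspace _ _ _).1 hv
  have key : ∀ (k : ℕ) (v : Fin n → ℂ),
      ((Matrix.toLin' M - μ • 1) ^ k) v = 0 → (Matrix.toLin' M - μ • 1) v = 0 := by
    intro k
    induction k with
    | zero =>
      intro v hv
      rw [pow_zero, Module.End.one_apply] at hv
      rw [hv, map_zero]
    | succ k ih =>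
      intro v hv
      rw [pow_succ, Module.End.mul_apply] at hv
      have h1 := ih _ hv
      refine h μ v _ ?_ ?_
      · simp
      · exact sub_eq_zero.1 h1
  have h2 : Matrix.toLin' M v = μ • v := sub_eq_zero.1 (key k v hk)
  by_cases h0 : v = 0
  · rw [h0]
    exact Submodule.zero_mem _
  · exact Submodule.subset_span ⟨μ, Module.End.hasEigenvector_iff.2
      ⟨Module.End.mem_eigenspace_iff.2 h2, h0⟩⟩

theorem exists_dotProduct_eigenvector_eq_zero (h : ¬ MatrixNonDefective M) :
    ∃ f : Fin n → ℂ, f ≠ 0 ∧ ∀ (μ : ℂ) (v : Fin n → ℂ), M *ᵥ v = μ • v → f ⬝ᵥ v = 0 := by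
  obtain ⟨φ, hφ, hker⟩ := Submodule.exists_le_ker_of_lt_top _
    (lt_top_iff_ne_top.2 fun h' => h (matrixNonDefective_of_span_eq_top h'))
  have hdot : ∀ v, φ v = (fun i => φ (Pi.single i 1)) ⬝ᵥ v := by
    intro v
    rw [LinearMap.pi_apply_eq_sum_univ φ v, dotProduct]
    refine Finset.sum_congr rfl fun i _ => ?_
    rw [smul_eq_mul, mul_comm]
    congr 2
    funext j
    simp [Pi.single_apply, eq_comm]
  refine ⟨fun i => φ (Pi.single i 1), fun h0 => hφ ?_, fun μ v hv => ?_⟩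
  · ext v
    simp only [LinearMap.comp_apply]
    exact congrFun h0 v
  · rw [← hdot]
    by_cases h0 : v = 0
    · rw [h0, map_zero]
    · exact hker (Submodule.subset_span ⟨μ, Module.End.hasEigenvector_iff.2
        ⟨Module.End.mem_eigenspace_iff.2 hv, h0⟩⟩)

end LinearAlgebra

/-! ### Eigenvectors and chains of the operator through the monodromy matrix -/

section Spectral

variable {n : ℕ} {T : ℝ} {A Φ Ψ : ℝ → Matrix (Fin n) (Fin n) ℂ}

theorem memLp_of_continuous (hT : 0 < T) {x : ℝ → Fin n → ℂ} (hx : Continuous x) :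
    MemLp (fun t => WithLp.toLp 2 (x t)) 2 (periodMeasure T) :=
  memLp_euclidean hT fun i =>
    memLp_of_continuousOn hT ((continuous_apply i).comp hx).continuousOn 2

theorem continuous_shiftedSolution (hΦ : Continuous Φ) (μ : ℂ) (c d : Fin n → ℂ) :
    Continuous (shiftedSolution Φ μ c d) := by
  unfold shiftedSolution
  fun_prop

/-- The phasors of the function `t ↦ e^{-μt} Φ(t) (c - t d)`. -/
def solutionPhasor (hT : 0 < T) (hΦ : Continuous Φ) (μ : ℂ) (c d : Fin n → ℂ) :
    EllTwo (Fin n × ℤ) :=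
  (vectorFourierBasis n hT).repr
    (memLp_of_continuous hT (continuous_shiftedSolution hΦ μ c d)).toLp

theorem shiftedSolution_period_iff (μ : ℂ) (c d : Fin n → ℂ) :
    shiftedSolution Φ μ c d T = c ↔
      Φ T *ᵥ c = Complex.exp (μ * T) • c + (T : ℂ) • (Φ T *ᵥ d) := by
  rw [shiftedSolution, Complex.exp_neg, inv_smul_eq_iff₀ (Complex.exp_ne_zero _),
    Matrix.mulVec_sub, Matrix.mulVec_smul, sub_eq_iff_eq_add]

theorem shiftedSolution_zero_right (hΦ0 : Φ 0 = 1) (μ : ℂ) (c d : Fin n → ℂ) :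
    shiftedSolution Φ μ c d 0 = c := by
  simp [shiftedSolution, hΦ0]

theorem solutionPhasor_zero (hT : 0 < T) (hΦ : Continuous Φ) (μ : ℂ) :
    solutionPhasor hT hΦ μ 0 0 = 0 := by
  have h : ∀ t, shiftedSolution Φ μ 0 0 t = 0 := fun t => by simp [shiftedSolution]
  rw [solutionPhasor, LinearIsometryEquiv.map_eq_zero_iff]
  refine Lp.ext ((MemLp.coeFn_toLp _).trans ?_)
  filter_upwards [Lp.coeFn_zero (EuclideanSpace ℂ (Fin n)) 2 (periodMeasure T)] with t ht
  rw [ht, h t]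
  rfl

theorem neBot_ae_periodMeasure (hT : 0 < T) : (ae (periodMeasure T)).NeBot := by
  rw [ae_periodMeasure hT, ae_neBot, ne_eq, Measure.restrict_eq_zero]
  simpa using hT

theorem eq_zero_of_solutionPhasor_eq_zero (hT : 0 < T) (hΨ : IsAdjointTransitionMatrix A Ψ)
    (hΦ : IsStateTransitionMatrix A Φ) {μ : ℂ} {c : Fin n → ℂ}
    (h : solutionPhasor hT hΦ.continuous μ c 0 = 0) : c = 0 := by
  rw [solutionPhasor, LinearIsometryEquiv.map_eq_zero_iff, Lp.eq_zero_iff_ae_eq_zero] at h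
  have := neBot_ae_periodMeasure hT
  obtain ⟨t, h1, h2⟩ := (h.and (MemLp.coeFn_toLp
    (memLp_of_continuous hT (continuous_shiftedSolution hΦ.continuous μ c 0)))).exists
  rw [h2] at h1
  have h3 : shiftedSolution Φ μ c 0 t = 0 := congrArg WithLp.ofLp h1
  rw [shiftedSolution, smul_eq_zero_iff_right (Complex.exp_ne_zero _), smul_zero, sub_zero] at h3
  rw [← Matrix.one_mulVec c, ← hΨ.mul_eq_one hΦ t, ← Matrix.mulVec_mulVec, h3, Matrix.mulVec_zero]

theorem harmonicStateOperator_solutionPhasor (hT : 0 < T)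
    (hA : ∀ i j, MemLp (fun t => A t i j) 2 (volume.restrict (Set.Ioc 0 T)))
    (hΦ : IsStateTransitionMatrix A Φ) {μ : ℂ} {c d : Fin n → ℂ}
    (h : shiftedSolution Φ μ c d T = c) :
    ∃ hX : solutionPhasor hT hΦ.continuous μ c d ∈ (harmonicStateOperator T A).domain,
      harmonicStateOperator T A ⟨_, hX⟩ = μ • solutionPhasor hT hΦ.continuous μ c d +
        solutionPhasor hT hΦ.continuous μ d 0 := by
  obtain ⟨h1, h2⟩ := hΦ.shiftedSolution μ c d
  have hc1 := continuous_shiftedSolution hΦ.continuous μ c d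
  have hc2 := continuous_shiftedSolution hΦ.continuous μ d 0
  obtain ⟨hX, hL⟩ := harmonicStateOperator_of_solution hT hA (h1 0 T)
    (z := fun t => μ • shiftedSolution Φ μ c d t + shiftedSolution Φ μ d 0 t)
    (by filter_upwards [h2] with t ht _ using ht)
    (by rw [h, shiftedSolution_zero_right hΦ.apply_zero])
    (memLp_of_continuous hT hc1) (memLp_of_continuous hT (by fun_prop))
  refine ⟨hX, hL.trans ?_⟩
  rw [solutionPhasor, solutionPhasor, ← map_smul, ← map_add]
  rfl

/-- Solving `(L - μ) X = Y` for an eigenfunction `Y` (or zero) is an inhomogeneous equation with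
periodic boundary values; variation of constants leaves only the initial value `c` free. -/
theorem exists_eq_solutionPhasor (hT : 0 < T)
    (hA : ∀ i j, MemLp (fun t => A t i j) 2 (volume.restrict (Set.Ioc 0 T)))
    (hΨ : IsAdjointTransitionMatrix A Ψ) (hΦ : IsStateTransitionMatrix A Φ) {μ : ℂ}
    {d : Fin n → ℂ} {X : EllTwo (Fin n × ℤ)} (hX : X ∈ (harmonicStateOperator T A).domain)
    (h : harmonicStateOperator T A ⟨X, hX⟩ = μ • X + solutionPhasor hT hΦ.continuous μ d 0) :
    ∃ c, X = solutionPhasor hT hΦ.continuous μ c d ∧ shiftedSolution Φ μ c d T = c := by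
  obtain ⟨x, hac, hper, ⟨hxL, rfl⟩, hz⟩ := exists_solution_of_mem_domain hT hA hX
  have hcd := memLp_of_continuous hT (continuous_shiftedSolution hΦ.continuous μ d 0)
  have hd := hz (fun t => μ • x t + shiftedSolution Φ μ d 0 t) ((hxL.const_smul μ).add hcd) (by
    rw [h, solutionPhasor, ← map_smul, ← map_add]
    rfl)
  have hsol : ∀ t ∈ Set.uIcc 0 T, x t = shiftedSolution Φ μ (x 0) d t := fun t ht =>
    eq_shiftedSolution hΨ hΦ μ d hac hd ht
  refine ⟨x 0, ?_, by rw [← hsol T (by simp), hper]⟩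
  rw [solutionPhasor]
  congr 1
  refine MemLp.toLp_congr _ _ ?_
  rw [Filter.EventuallyEq, ae_periodMeasure hT]
  filter_upwards [ae_restrict_mem measurableSet_Ioc] with t ht
  rw [hsol t (by rw [Set.uIcc_of_le hT.le]; exact Set.Ioc_subset_Icc_self ht)]

theorem exists_eq_solutionPhasor_of_eigen (hT : 0 < T)
    (hA : ∀ i j, MemLp (fun t => A t i j) 2 (volume.restrict (Set.Ioc 0 T)))
    (hΨ : IsAdjointTransitionMatrix A Ψ) (hΦ : IsStateTransitionMatrix A Φ) {μ : ℂ}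
    {X : EllTwo (Fin n × ℤ)} (hX : X ∈ (harmonicStateOperator T A).domain)
    (h : harmonicStateOperator T A ⟨X, hX⟩ = μ • X) :
    ∃ c, X = solutionPhasor hT hΦ.continuous μ c 0 ∧ Φ T *ᵥ c = Complex.exp (μ * T) • c := by
  obtain ⟨c, h1, h2⟩ := exists_eq_solutionPhasor hT hA hΨ hΦ (d := 0) hX
    (by rw [h, solutionPhasor_zero, add_zero])
  refine ⟨c, h1, ?_⟩
  simpa using (shiftedSolution_period_iff μ c 0).1 h2

theorem everyGenEigenvectorIsEigenvector_of_matrixNonDefective (hT : 0 < T)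
    (hA : ∀ i j, MemLp (fun t => A t i j) 2 (volume.restrict (Set.Ioc 0 T)))
    (hΨ : IsAdjointTransitionMatrix A Ψ) (hΦ : IsStateTransitionMatrix A Φ)
    (hM : MatrixNonDefective (Φ T)) :
    EveryGenEigenvectorIsEigenvector (harmonicStateOperator T A) := by
  intro μ k x hk hx
  refine ⟨hx, ?_⟩
  -- The induction hypothesis is applied to `(L - μ) x`, which may vanish.
  clear hx
  induction k generalizing x with
  | zero =>
    obtain rfl : x = 0 := hk
    exact ⟨Submodule.zero_mem _, by rw [smul_zero]; exact LinearPMap.map_zero _⟩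
  | succ k ih =>
    obtain ⟨hxd, hk⟩ := hk
    refine ⟨hxd, ?_⟩
    obtain ⟨hyd, hy⟩ := ih _ hk
    obtain ⟨d, hd, hMd⟩ := exists_eq_solutionPhasor_of_eigen hT hA hΨ hΦ hyd hy
    obtain ⟨c, -, hc⟩ := exists_eq_solutionPhasor hT hA hΨ hΦ hxd
      (by rw [← hd]; abel)
    -- Periodicity of `x` makes `c` and `T e^{μT} d` a Jordan chain of `Φ T`, hence `d = 0`.
    rw [shiftedSolution_period_iff, hMd] at hc
    have h0 := hM.eq_zero_of_jordan_chain hc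
      (by rw [Matrix.mulVec_smul, Matrix.mulVec_smul, hMd, smul_comm (Complex.exp (μ * T)) (T : ℂ)])
    have hT' : (T : ℂ) ≠ 0 := by exact_mod_cast hT.ne'
    rw [smul_eq_zero_iff_right hT', smul_eq_zero_iff_right (Complex.exp_ne_zero _)] at h0
    rw [h0, solutionPhasor_zero] at hd
    exact sub_eq_zero.1 hd

theorem matrixNonDefective_of_everyGenEigenvectorIsEigenvector (hT : 0 < T)
    (hA : ∀ i j, MemLp (fun t => A t i j) 2 (volume.restrict (Set.Ioc 0 T)))
    (hΨ : IsAdjointTransitionMatrix A Ψ) (hΦ : IsStateTransitionMatrix A Φ)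
    (hL : EveryGenEigenvectorIsEigenvector (harmonicStateOperator T A)) :
    MatrixNonDefective (Φ T) := by
  have hT' : (T : ℂ) ≠ 0 := by exact_mod_cast hT.ne'
  refine matrixNonDefective_of_jordan_chain fun μ c d hc hd => ?_
  by_contra hd0
  have hμ : μ ≠ 0 := by
    rintro rfl
    refine hd0 ?_
    rw [← Matrix.one_mulVec d, ← hΨ.mul_eq_one hΦ T, ← Matrix.mulVec_mulVec, hd, zero_smul,
      Matrix.mulVec_zero]
  set ν : ℂ := Complex.log μ / T with hν
  have hexp : Complex.exp (ν * T) = μ := by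
    rw [hν, div_mul_cancel₀ _ hT', Complex.exp_log hμ]
  -- Rescaled so that the periodicity defect `T Φ(T) e` is exactly `d`.
  set e : Fin n → ℂ := (T * μ)⁻¹ • d with he
  have hde : (T * μ) • e = d := smul_inv_smul₀ (mul_ne_zero hT' hμ) d
  have hMe : Φ T *ᵥ e = μ • e := by
    rw [he, Matrix.mulVec_smul, hd, smul_comm]
  have hpc : shiftedSolution Φ ν c e T = c := by
    rw [shiftedSolution_period_iff, hexp, hMe, smul_smul, hde, hc]
  have hpe : shiftedSolution Φ ν e 0 T = e := by
    rw [shiftedSolution_period_iff, hexp, hMe, Matrix.mulVec_zero, smul_zero, add_zero]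
  obtain ⟨h1, h2⟩ := harmonicStateOperator_solutionPhasor hT hA hΦ hpc
  obtain ⟨h3, h4⟩ := harmonicStateOperator_solutionPhasor hT hA hΦ hpe
  rw [solutionPhasor_zero, add_zero] at h4
  -- The hypothesis only concerns nonzero vectors; if this one were zero, so would be its image
  -- under `L - ν`, the phasors attached to `e`.
  have hX : solutionPhasor hT hΦ.continuous ν c e ≠ 0 ∨
      solutionPhasor hT hΦ.continuous ν e 0 = 0 := by
    by_contra! hX
    refine hX.2 ?_
    have h5 : harmonicStateOperator T A ⟨_, h1⟩ = 0 := by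
      convert LinearPMap.map_zero (harmonicStateOperator T A)
      exact hX.1
    rw [h5, hX.1, smul_zero, zero_add] at h2
    exact h2.symm
  have hY : solutionPhasor hT hΦ.continuous ν e 0 = 0 := by
    rcases hX with hX | hX
    · have h6 : harmonicStateOperator T A ⟨_, h1⟩ - ν • solutionPhasor hT hΦ.continuous ν c e =
          solutionPhasor hT hΦ.continuous ν e 0 := by rw [h2, add_sub_cancel_left]
      obtain ⟨_, _, h5⟩ := hL ν 2 _ ⟨h1, by
        rw [h6]
        exact ⟨h3, sub_eq_zero.2 h4⟩⟩ hX
      rw [h5] at h6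
      rw [← h6, sub_self]
    · exact hX
  have := eq_zero_of_solutionPhasor_eq_zero hT hΨ hΦ hY
  rw [← hde, this, smul_zero] at hd0
  exact hd0 rfl

theorem matrixNonDefective_of_hasRieszBasisOfEigenvectors (hT : 0 < T)
    (hA : ∀ i j, MemLp (fun t => A t i j) 2 (volume.restrict (Set.Ioc 0 T)))
    (hΨ : IsAdjointTransitionMatrix A Ψ) (hΦ : IsStateTransitionMatrix A Φ)
    (hL : HasRieszBasisOfEigenvectors (harmonicStateOperator T A)) :
    MatrixNonDefective (Φ T) := by
  by_contra hM
  obtain ⟨f, hf0, hf⟩ := exists_dotProduct_eigenvector_eq_zero hM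
  obtain ⟨ι, _, S, hS⟩ := hL
  have hΨc := hΨ.continuous
  -- The `star` offsets conjugation in the first slot: the integrand against `e^{-μt} Φ(t) c`
  -- becomes `e^{-μt} (f ⬝ c) = 0`.
  have hyc : Continuous fun t => star (f ᵥ* Ψ t) := by fun_prop
  set y : PeriodL2 n T := (memLp_of_continuous hT hyc).toLp with hy
  set Y := (vectorFourierBasis n hT).repr y with hY
  have horth : ∀ i, inner ℂ Y (S (lp.single 2 i 1)) = 0 := by
    intro i
    obtain ⟨μ, -, hd, he⟩ := hS i
    obtain ⟨c, hc, hMc⟩ := exists_eq_solutionPhasor_of_eigen hT hA hΨ hΦ hd he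
    rw [hc, solutionPhasor, hY, LinearIsometryEquiv.inner_map_map, L2.inner_def]
    refine integral_eq_zero_of_ae ?_
    filter_upwards [(memLp_of_continuous hT hyc).coeFn_toLp, (memLp_of_continuous hT
      (continuous_shiftedSolution hΦ.continuous μ c 0)).coeFn_toLp] with t h1 h2
    rw [h2, hy, h1, EuclideanSpace.inner_toLp_toLp, star_star, shiftedSolution, smul_zero, sub_zero,
      dotProduct_comm, dotProduct_smul, ← Matrix.dotProduct_mulVec, Matrix.mulVec_mulVec,
      hΨ.mul_eq_one hΦ, Matrix.one_mulVec, hf _ _ hMc, smul_zero]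
    rfl
  -- All coordinates of `S* Y` vanish; as `S` is onto, `Y` is then orthogonal to itself.
  have hadj : ContinuousLinearMap.adjoint (S : EllTwo ι →L[ℂ] EllTwo (Fin n × ℤ)) Y = 0 := by
    ext i
    have h := ContinuousLinearMap.adjoint_inner_left
      (S : EllTwo ι →L[ℂ] EllTwo (Fin n × ℤ)) (lp.single 2 i 1) Y
    rw [ContinuousLinearEquiv.coe_coe, horth i, lp.inner_single_right] at h
    simpa using h
  have hY0 : Y = 0 := by
    have h := ContinuousLinearMap.adjoint_inner_left
      (S : EllTwo ι →L[ℂ] EllTwo (Fin n × ℤ)) (S.symm Y) Y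
    rw [hadj, inner_zero_left, ContinuousLinearEquiv.coe_coe,
      ContinuousLinearEquiv.apply_symm_apply] at h
    exact inner_self_eq_zero.1 h.symm
  rw [hY, LinearIsometryEquiv.map_eq_zero_iff, Lp.eq_zero_iff_ae_eq_zero] at hY0
  have := neBot_ae_periodMeasure hT
  obtain ⟨t, h1, h2⟩ := (hY0.and (memLp_of_continuous hT hyc).coeFn_toLp).exists
  rw [hy, h2] at h1
  have h3 : star (f ᵥ* Ψ t) = 0 := congrArg WithLp.ofLp h1
  rw [star_eq_zero] at h3
  refine hf0 ?_
  rw [← Matrix.vecMul_one f, ← hΨ.mul_eq_one hΦ t, ← Matrix.vecMul_vecMul, h3, Matrix.zero_vecMul]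

end Spectral

/-! ### Multiplication operators by continuous matrix functions -/

section Multiplication

variable {n : ℕ} {T : ℝ}

theorem memLp_top_toEuclideanCLM (hT : 0 < T) {Q : ℝ → Matrix (Fin n) (Fin n) ℂ}
    (hQ : Continuous Q) :
    MemLp (fun t => Matrix.toEuclideanCLM (n := Fin n) (𝕜 := ℂ) (Q t)) ⊤ (periodMeasure T) := by
  refine (memLp_periodMeasure hT).2 (memLp_of_continuousOn hT (Continuous.continuousOn ?_) ⊤)
  exact (LinearMap.continuous_of_finiteDimensional
    (Matrix.toEuclideanCLM (n := Fin n) (𝕜 := ℂ)).toAlgEquiv.toLinearMap).comp hQ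

/-- Multiplication by a continuous matrix function on `L²((0, T]; ℂⁿ)`. -/
def multiplicationCLM (hT : 0 < T) {Q : ℝ → Matrix (Fin n) (Fin n) ℂ} (hQ : Continuous Q) :
    PeriodL2 n T →L[ℂ] PeriodL2 n T :=
  (ContinuousLinearMap.id ℂ (EuclideanSpace ℂ (Fin n) →L[ℂ] EuclideanSpace ℂ (Fin n))).holderL
    (periodMeasure T) ⊤ 2 2 (memLp_top_toEuclideanCLM hT hQ).toLp

theorem multiplicationCLM_coeFn (hT : 0 < T) {Q : ℝ → Matrix (Fin n) (Fin n) ℂ} (hQ : Continuous Q)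
    (x : PeriodL2 n T) :
    multiplicationCLM hT hQ x =ᵐ[periodMeasure T] fun t => WithLp.toLp 2 (Q t *ᵥ x t) := by
  have h := (ContinuousLinearMap.id ℂ
    (EuclideanSpace ℂ (Fin n) →L[ℂ] EuclideanSpace ℂ (Fin n))).coeFn_holder (r := 2)
    (memLp_top_toEuclideanCLM hT hQ).toLp x
  filter_upwards [h, (memLp_top_toEuclideanCLM hT hQ).coeFn_toLp] with t h1 h2
  rw [multiplicationCLM, ContinuousLinearMap.holderL_apply_apply, h1, h2]
  rfl

theorem multiplicationCLM_comp_of_mul_eq_one (hT : 0 < T) {Q R : ℝ → Matrix (Fin n) (Fin n) ℂ}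
    (hQ : Continuous Q) (hR : Continuous R) (h : ∀ t, Q t * R t = 1) (x : PeriodL2 n T) :
    multiplicationCLM hT hQ (multiplicationCLM hT hR x) = x := by
  refine Lp.ext ?_
  filter_upwards [multiplicationCLM_coeFn hT hQ (multiplicationCLM hT hR x),
    multiplicationCLM_coeFn hT hR x] with t h1 h2
  rw [h1, h2, Matrix.mulVec_mulVec, h, Matrix.one_mulVec]

/-- Multiplication by a continuous matrix function with continuous inverse. -/
def multiplicationEquiv (hT : 0 < T) {Q R : ℝ → Matrix (Fin n) (Fin n) ℂ}
    (hQ : Continuous Q) (hR : Continuous R) (h : ∀ t, Q t * R t = 1) :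
    PeriodL2 n T ≃L[ℂ] PeriodL2 n T :=
  ContinuousLinearEquiv.equivOfInverse (multiplicationCLM hT hQ) (multiplicationCLM hT hR)
    (multiplicationCLM_comp_of_mul_eq_one hT hR hQ fun t => mul_eq_one_comm.1 (h t))
    (multiplicationCLM_comp_of_mul_eq_one hT hQ hR h)

end Multiplication

/-! ### Floquet factor and the Riesz basis of eigenvectors -/

section RieszBasis

variable {n : ℕ} {T : ℝ} {A Φ Ψ : ℝ → Matrix (Fin n) (Fin n) ℂ}

theorem hasRieszBasisOfEigenvectors_of_matrixNonDefective (hT : 0 < T)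
    (hA : ∀ i j, MemLp (fun t => A t i j) 2 (volume.restrict (Set.Ioc 0 T)))
    (hΨ : IsAdjointTransitionMatrix A Ψ) (hΦ : IsStateTransitionMatrix A Φ)
    (hM : MatrixNonDefective (Φ T)) :
    HasRieszBasisOfEigenvectors (harmonicStateOperator T A) := by
  have hT' : (T : ℂ) ≠ 0 := by exact_mod_cast hT.ne'
  obtain ⟨b, hb⟩ := hM
  choose m hm using hb
  have hbm : ∀ i, Φ T *ᵥ b i = m i • b i := fun i => (hm i).apply_eq_smul
  have hm0 : ∀ i, m i ≠ 0 := by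
    intro i h0
    refine (hm i).2 ?_
    rw [← Matrix.one_mulVec (b i), ← hΨ.mul_eq_one hΦ T, ← Matrix.mulVec_mulVec, hbm, h0,
      zero_smul, Matrix.mulVec_zero]
  set ν : Fin n → ℂ := fun i => Complex.log (m i) / T with hν
  have hexp : ∀ i, Complex.exp (ν i * T) = m i := fun i => by
    rw [hν, div_mul_cancel₀ _ hT', Complex.exp_log (hm0 i)]
  set P : Matrix (Fin n) (Fin n) ℂ := (Pi.basisFun ℂ (Fin n)).toMatrix b with hP
  set P' : Matrix (Fin n) (Fin n) ℂ := b.toMatrix (Pi.basisFun ℂ (Fin n)) with hP'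
  have hPP : P * P' = 1 := Module.Basis.toMatrix_mul_toMatrix_flip _ _
  -- The Floquet factor: column `i` is `e^{-ν_i t} Φ(t) b_i`. Together with its inverse `R` it acts
  -- boundedly on `L²`.
  set Q : ℝ → Matrix (Fin n) (Fin n) ℂ := fun t =>
    Φ t * P * Matrix.diagonal fun i => Complex.exp (-(ν i * t)) with hQ
  set R : ℝ → Matrix (Fin n) (Fin n) ℂ := fun t =>
    (Matrix.diagonal fun i => Complex.exp (ν i * t)) * P' * Ψ t with hR
  have hΦc := hΦ.continuous
  have hΨc := hΨ.continuous
  have hQc : Continuous Q := by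
    refine (hΦc.matrix_mul continuous_const).matrix_mul (Continuous.matrix_diagonal ?_)
    fun_prop
  have hRc : Continuous R := by
    refine ((Continuous.matrix_diagonal ?_).matrix_mul continuous_const).matrix_mul hΨc
    fun_prop
  have hQR : ∀ t, Q t * R t = 1 := by
    intro t
    have h1 : (Matrix.diagonal fun i => Complex.exp (-(ν i * t))) *
        (Matrix.diagonal fun i => Complex.exp (ν i * t)) = (1 : Matrix (Fin n) (Fin n) ℂ) := by
      rw [Matrix.diagonal_mul_diagonal, ← Matrix.diagonal_one]
      congr 1
      funext i
      rw [← Complex.exp_add, neg_add_cancel, Complex.exp_zero]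
    calc Q t * R t = Φ t * (P * ((Matrix.diagonal fun i => Complex.exp (-(ν i * t))) *
        (Matrix.diagonal fun i => Complex.exp (ν i * t))) * P') * Ψ t := by
          simp only [hQ, hR, Matrix.mul_assoc]
      _ = 1 := by rw [h1, Matrix.mul_one, hPP, Matrix.mul_one, hΨ.mul_eq_one' hΦ]
  set F := (vectorFourierBasis n hT).repr with hF
  refine ⟨Fin n × ℤ, inferInstance, (F.symm.toContinuousLinearEquiv.trans
    (multiplicationEquiv hT hQc hRc hQR)).trans F.toContinuousLinearEquiv, fun r => ?_⟩
  -- Multiplying by the mode `e^{jωkt}` shifts the exponent to `ν_i - jωk`, another logarithm of `m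
  -- i` divided by `T`.
  set μ : ℂ := ν r.1 - Complex.I * ((2 * Real.pi / T : ℝ) : ℂ) * (r.2 : ℂ) with hμ
  have hsol : ∀ t : ℝ, Q t *ᵥ vectorMode T r t = shiftedSolution Φ μ (b r.1) 0 t := by
    intro t
    have h1 : (Matrix.diagonal fun i => Complex.exp (-(ν i * t))) *ᵥ vectorMode T r t =
        Complex.exp (-(μ * t)) • Pi.single r.1 1 := by
      funext i
      rw [Matrix.mulVec_diagonal, vectorMode, Pi.smul_apply, Pi.single_apply, Pi.single_apply]
      split_ifs with h
      · rw [h, fourierMode, ← Complex.exp_add, smul_eq_mul, mul_one, hμ]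
        congr 1
        ring
      · simp
    have h2 : P *ᵥ Pi.single r.1 1 = b r.1 := by
      rw [Matrix.mulVec_single_one]
      rfl
    simp only [hQ]
    rw [← Matrix.mulVec_mulVec, h1, Matrix.mulVec_smul, ← Matrix.mulVec_mulVec, h2,
      shiftedSolution, smul_zero, sub_zero]
  have hS : ((F.symm.toContinuousLinearEquiv.trans
      (multiplicationEquiv hT hQc hRc hQR)).trans F.toContinuousLinearEquiv)
        (lp.single 2 r (1 : ℂ)) = solutionPhasor hT hΦ.continuous μ (b r.1) 0 := by
    change F (multiplicationCLM hT hQc (F.symm (lp.single 2 r (1 : ℂ)))) = _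
    rw [hF, HilbertBasis.repr_symm_single, coe_vectorFourierBasis, solutionPhasor]
    congr 1
    refine Lp.ext ?_
    filter_upwards [multiplicationCLM_coeFn hT hQc (memLp_vectorMode hT r).toLp,
      (memLp_vectorMode hT r).coeFn_toLp, (memLp_of_continuous hT
        (continuous_shiftedSolution hΦ.continuous μ (b r.1) 0)).coeFn_toLp] with t h1 h2 h3
    rw [h1, h2, h3, hsol]
  have hper : shiftedSolution Φ μ (b r.1) 0 T = b r.1 := by
    have h1 : Complex.exp (μ * T) = m r.1 := by
      have h2 : Complex.exp (-(Complex.I * ((2 * Real.pi / T : ℝ) : ℂ) * (r.2 : ℂ) * T)) = 1 := by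
        rw [← fourierMode_period hT (-r.2), fourierMode]
        congr 1
        push_cast
        ring
      rw [hμ, sub_mul, sub_eq_add_neg, Complex.exp_add, hexp, h2, mul_one]
    rw [shiftedSolution_period_iff, h1, hbm, Matrix.mulVec_zero, smul_zero, add_zero]
  obtain ⟨h1, h2⟩ := harmonicStateOperator_solutionPhasor hT hA hΦ hper
  rw [solutionPhasor_zero, add_zero] at h2
  refine ⟨μ, ?_⟩
  rw [hS]
  exact ⟨fun h0 => (hm r.1).2 (eq_zero_of_solutionPhasor_eq_zero hT hΨ hΦ h0), h1, h2⟩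

end RieszBasis

end

/-! ### Assembly of the main theorem -/

theorem mainTheorem12 (n : ℕ) (T : ℝ) (hT : 0 < T) (A : ℝ → Matrix (Fin n) (Fin n) ℂ)
    (hper : Function.Periodic A T)
    (hL2 : ∀ i j, MemLp (fun t => A t i j) 2 (volume.restrict (Set.Icc 0 T))) :
    ∃ Φ : ℝ → Matrix (Fin n) (Fin n) ℂ,
      (IsStateTransitionMatrix A Φ ∧ ∀ Ψ, IsStateTransitionMatrix A Ψ → Ψ = Φ) ∧
      (HasRieszBasisOfEigenvectors (harmonicStateOperator T A) ↔ MatrixNonDefective (Φ T)) ∧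
      (EveryGenEigenvectorIsEigenvector (harmonicStateOperator T A) ↔
        MatrixNonDefective (Φ T)) := by
  have hA : ∀ i j, MemLp (fun t => A t i j) 2 (volume.restrict (Set.Ioc 0 T)) := fun i j =>
    (hL2 i j).mono_measure (Measure.restrict_mono Set.Ioc_subset_Icc_self le_rfl)
  -- Square integrability on one period gives integrability there, and periodicity spreads it to
  -- every bounded interval.
  have hint : ∀ i j a b, IntervalIntegrable (fun t => A t i j) volume a b := fun i j a b =>
    Function.Periodic.intervalIntegrable₀ (fun t => congrFun (congrFun (hper t) i) j) hT.ne'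
      (intervalIntegrable_of_memLp_two hT (hA i j)) a b
  obtain ⟨Φ, hΦ⟩ := exists_isStateTransitionMatrix hint
  obtain ⟨Ψ, hΨ⟩ := exists_isAdjointTransitionMatrix hint
  exact ⟨Φ, ⟨hΦ, fun _ h => hΦ.unique hΨ h⟩,
    ⟨matrixNonDefective_of_hasRieszBasisOfEigenvectors hT hA hΨ hΦ,
      hasRieszBasisOfEigenvectors_of_matrixNonDefective hT hA hΨ hΦ⟩,
    ⟨matrixNonDefective_of_everyGenEigenvectorIsEigenvector hT hA hΨ hΦ,
      everyGenEigenvectorIsEigenvector_of_matrixNonDefective hT hA hΨ hΦ⟩⟩
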